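/- Let $n\ge 1$ and let $X$ be an arbitrary real Banach space. Equip $\mathbb{R}^{n+1}_+=\mathbb{R}^n\times(0,\infty)$ with the measure $d\mu = dy\,dt/t^{n+1}$, and let $W$ be a Gaussian random measure on $(\mathbb{R}^{n+1}_+,\mu)$ over some probability space: each measurable $A$ with $\mu(A)<\infty$ is sent to a centered Gaussian random variable $W(A)$ with variance $\mu(A)$, and for disjoint sets the variables $W(A_1),\dots,W(A_m)$ are independent and $W(A\cup B)=W(A)+W(B)$ almost surely for disjoint $A,B$. Let $h\mapsto\int h\,dW$ be the isometry $L^2(\mu)\to L^2(\mathbb{P})$ extending $1_A\mapsto W(A)$. For $f:\mathbb{R}^{n+1}_+\to X$, $\int f\,dW$ denotes the $X$-valued random variable with $\langle\int f\,dW,\xi^*\rangle=\int\langle f,\xi^*\rangle\,dW$ almost surely for every $\xi^*\in X^*$, and $\int_A f\,dW=\int 1_Af\,dW$; these exist if $1_Af$ lies in the algebraic tensor product $L^2(\mu)\otimes X$. Write $\Gamma(x)=\{(y,t)\in\mathbb{R}^{n+1}_+:|x-y|<t\}$ and, for a ball $B\subset\mathbb{R}^n$, $\widehat B=\{(y,t)\in\mathbb{R}^{n+1}_+: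 B(y,t)\subset B\}$. A $T^1(X)$ function is a function $f:\mathbb{R}^{n+1}_+\to X$ such that $1_{\Gamma(x)}f\in L^2(\mu)\otimes X$ for almost every $x\in\mathbb{R}^n$ and $$\|f\|_{T^1(X)}=\int_{\mathbb{R}^n}\Big(\mathbb{E}\Big\|\int_{\Gamma(x)}f\,dW\Big\|^2\Big)^{1/2}dx<\infty ,$$ and the tent space $T^1(X)$ is the completion, under this norm, of the space of (equivalence classes of) $T^1(X)$ functions. A $T^1(X)$ atom is a function $a:\mathbb{R}^{n+1}_+\to X$ such that, for some open ball $B$ of positive radius, $a$ is supported in $\widehat B$, $1_{\Gamma(x)}a\in L^2(\mu)\otimes X$ for almost every $x\in B$, and $$\int_B\mathbb{E}\Big\|\int_{\Gamma(x)}a\,dW\Big\|^2dx\le\frac1{|B|}.$$ Then there is a constant $C>0$ depending only on $n$ such that for every $f\in T^1(X)$ there exist countably many $T^1(X)$ atoms $a_k$ and real numbers $\lambda_k$ with $$f=\sum_k\lambda_ka_k\quad\text{and}\quad\sum_k|\lambda_k|\le C\,\|f\|_{T^1(X)},$$ where the series converges unconditionally in $T^1(X)$. If $f$ is a $T^1(X)$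 function, the $a_k$ and $\lambda_k$ can moreover be chosen so that, in addition, the series converges to $f$ pointwise almost everywhere. -/

import Mathlib

open MeasureTheory ProbabilityTheory
open scoped ENNReal NNReal

/-- A Gaussian random measure on `(M, μ)` over the probability space `(Ω, P)`: every measurable set
`A` of finite measure is sent to a centered Gaussian random variable `W A` of variance `μ A`,
disjoint sets are sent to independent random variables, and `W (A ∪ B) = W A + W B` almost surely
for disjoint `A` and `B`. (Independence is required of finite disjoint families, as usual, so that
the random variables `W A` are jointly Gaussian. Values on other sets are immaterial.) -/
structure GaussianRandomMeasure {M Ω : Type*} [MeasurableSpace M] [MeasurableSpace Ω]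
    (μ : Measure M) (P : Measure Ω) where
  toFun : Set M → Ω → ℝ
  hasLaw : ∀ A : Set M, MeasurableSet A → μ A < ∞ →
    HasLaw (toFun A) (gaussianReal 0 (μ A).toNNReal) P
  indep : ∀ (m : ℕ) (A : Fin m → Set M), (∀ i, MeasurableSet (A i)) → (∀ i, μ (A i) < ∞) →
    Pairwise (fun i j => Disjoint (A i) (A j)) → iIndepFun (fun i => toFun (A i)) P
  union : ∀ A B : Set M, MeasurableSet A → MeasurableSet B → μ A < ∞ → μ B < ∞ →
    Disjoint A B → toFun (A ∪ B) =ᵐ[P] fun ω => toFun A ω + toFun B ω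

namespace GaussianRandomMeasure

variable {M Ω : Type*} [MeasurableSpace M] [MeasurableSpace Ω] {μ : Measure M} {P : Measure Ω}

/-- Measurable sets of finite measure. -/
abbrev FiniteSet (μ : Measure M) : Type _ := {A : Set M // MeasurableSet A ∧ μ A < ∞}

variable (W : GaussianRandomMeasure μ P)

theorem memLp (A : FiniteSet μ) : MemLp (W.toFun A.1) 2 P := by
  have h := W.hasLaw A.1 A.2.1 A.2.2
  have h2 : MemLp id 2 (Measure.map (W.toFun A.1) P) := by
    rw [h.map_eq]; exact memLp_id_gaussianReal' 2 (by simp)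
  exact (memLp_map_measure_iff aestronglyMeasurable_id h.aemeasurable).1 h2

theorem integral_mul_self (A : FiniteSet μ) :
    ∫ ω, W.toFun A.1 ω * W.toFun A.1 ω ∂P = μ.real A.1 := by
  have h := W.hasLaw A.1 A.2.1 A.2.2
  have h1 : ∫ ω, W.toFun A.1 ω * W.toFun A.1 ω ∂P
      = ∫ x, x * x ∂(gaussianReal 0 (μ A.1).toNNReal) := by
    rw [← h.map_eq, integral_map h.aemeasurable (by fun_prop)]
  have h2 := variance_id_gaussianReal (μ := 0) (v := (μ A.1).toNNReal)
  rw [variance_eq_integral (by fun_prop)] at h2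
  simp only [id, integral_id_gaussianReal, sub_zero] at h2
  rw [h1]
  simp only [pow_two] at h2
  rw [h2]; rfl

theorem integral_eq_zero (A : FiniteSet μ) : ∫ ω, W.toFun A.1 ω ∂P = 0 := by
  have h := W.hasLaw A.1 A.2.1 A.2.2
  rw [h.integral_eq, integral_id_gaussianReal]

theorem integral_mul_of_disjoint (A B : FiniteSet μ) (hAB : Disjoint A.1 B.1) :
    ∫ ω, W.toFun A.1 ω * W.toFun B.1 ω ∂P = 0 := by
  have hi := W.indep 2 ![A.1, B.1]
    (by intro i; fin_cases i; exacts [A.2.1, B.2.1])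
    (by intro i; fin_cases i; exacts [A.2.2, B.2.2])
    (by intro i j hij; fin_cases i <;> fin_cases j <;> simp_all [disjoint_comm])
  have h01 := hi.indepFun (i := 0) (j := 1) (by simp)
  simp only [Matrix.cons_val_zero, Matrix.cons_val_one] at h01
  rw [h01.integral_fun_mul_eq_mul_integral (W.memLp A).1 (W.memLp B).1, W.integral_eq_zero A,
    zero_mul]

theorem integral_mul (A B : FiniteSet μ) :
    ∫ ω, W.toFun A.1 ω * W.toFun B.1 ω ∂P = μ.real (A.1 ∩ B.1) := by
  let C : FiniteSet μ := ⟨A.1 ∩ B.1, A.2.1.inter B.2.1,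
    (measure_mono Set.inter_subset_left).trans_lt A.2.2⟩
  let A' : FiniteSet μ := ⟨A.1 \ B.1, A.2.1.diff B.2.1,
    (measure_mono Set.sdiff_subset).trans_lt A.2.2⟩
  let B' : FiniteSet μ := ⟨B.1 \ A.1, B.2.1.diff A.2.1,
    (measure_mono Set.sdiff_subset).trans_lt B.2.2⟩
  have dA : Disjoint A'.1 C.1 := by
    rw [Set.disjoint_left]; rintro x ⟨_, h⟩ ⟨_, h'⟩; exact h h'
  have dB : Disjoint C.1 B'.1 := by
    rw [Set.disjoint_left]; rintro x ⟨h', _⟩ ⟨_, h⟩; exact h h'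
  have dAB : Disjoint A'.1 B'.1 := by
    rw [Set.disjoint_left]; rintro x ⟨h', _⟩ ⟨_, h⟩; exact h h'
  have eA := W.union A'.1 C.1 A'.2.1 C.2.1 A'.2.2 C.2.2 dA
  have eB := W.union C.1 B'.1 C.2.1 B'.2.1 C.2.2 B'.2.2 dB
  have sA : A'.1 ∪ C.1 = A.1 := Set.sdiff_union_inter A.1 B.1
  have sB : C.1 ∪ B'.1 = B.1 := by
    simp only [C, B']; rw [Set.inter_comm]; exact Set.inter_union_sdiff B.1 A.1
  rw [sA] at eA
  rw [sB] at eB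
  have key : ∫ ω, W.toFun A.1 ω * W.toFun B.1 ω ∂P
      = ∫ ω, ((W.toFun A'.1 ω * W.toFun C.1 ω + W.toFun A'.1 ω * W.toFun B'.1 ω)
        + (W.toFun C.1 ω * W.toFun C.1 ω + W.toFun C.1 ω * W.toFun B'.1 ω)) ∂P := by
    apply integral_congr_ae
    filter_upwards [eA, eB] with ω h1 h2
    rw [h1, h2]; ring
  have i (S T : FiniteSet μ) : Integrable (fun ω => W.toFun S.1 ω * W.toFun T.1 ω) P :=
    (W.memLp S).integrable_mul (W.memLp T)
  rw [key, integral_add, integral_add, integral_add, W.integral_mul_of_disjoint A' C dA,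
    W.integral_mul_of_disjoint A' B' dAB, W.integral_mul_of_disjoint C B' dB, W.integral_mul_self C]
  · simp [C]
  · exact i _ _
  · exact i _ _
  · exact i _ _
  · exact i _ _
  · exact (i _ _).add (i _ _)
  · exact (i _ _).add (i _ _)

/-- The linear map sending a formal combination of sets to the same combination of indicators. -/
noncomputable def stepMap (μ : Measure M) : (FiniteSet μ →₀ ℝ) →ₗ[ℝ] Lp ℝ 2 μ :=
  Finsupp.linearCombination ℝ fun A : FiniteSet μ => indicatorConstLp 2 A.2.1 A.2.2.ne (1 : ℝ)

/-- The linear map sending a formal combination of sets to the same combination of the `W A`. -/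
noncomputable def stepIntegral : (FiniteSet μ →₀ ℝ) →ₗ[ℝ] Lp ℝ 2 P :=
  Finsupp.linearCombination ℝ fun A : FiniteSet μ => (W.memLp A).toLp (W.toFun A.1)

/-- The scalar stochastic integral `h ↦ ∫ h dW`: the extension of `1_A ↦ W A` by linearity and
density to the whole of `L²(μ)`; see `scalarIntegral_indicator` and `norm_scalarIntegral`. -/
noncomputable def scalarIntegral : Lp ℝ 2 μ →L[ℝ] Lp ℝ 2 P :=
  W.stepIntegral.extendOfNorm (stepMap μ)

theorem inner_stepIntegral (c d : FiniteSet μ →₀ ℝ) :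
    inner ℝ (W.stepIntegral c) (W.stepIntegral d) = inner ℝ (stepMap μ c) (stepMap μ d) := by
  induction c using Finsupp.induction_linear with
  | zero => simp
  | add c c' h h' => simp only [map_add, inner_add_left, h, h']
  | single A r =>
    induction d using Finsupp.induction_linear with
    | zero => simp
    | add c c' h h' => simp only [map_add, inner_add_right, h, h']
    | single B s =>
      simp only [stepIntegral, stepMap, Finsupp.linearCombination_single, inner_smul_left,
        inner_smul_right, L2.inner_indicatorConstLp_one]
      congr 2
      rw [L2.inner_def]
      have h1 : ∫ ω, inner ℝ ((W.memLp A).toLp (W.toFun A.1) ω) ((W.memLp B).toLp (W.toFun B.1) ω) ∂P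
          = ∫ ω, W.toFun A.1 ω * W.toFun B.1 ω ∂P := by
        apply integral_congr_ae
        filter_upwards [(W.memLp A).coeFn_toLp, (W.memLp B).coeFn_toLp] with ω h1 h2
        rw [h1, h2]; simp [mul_comm]
      rw [h1, W.integral_mul A B]
      have h2 : ∫ x in A.1, (indicatorConstLp 2 B.2.1 B.2.2.ne (1 : ℝ)) x ∂μ
          = ∫ x in A.1, B.1.indicator (fun _ => (1 : ℝ)) x ∂μ :=
        integral_congr_ae (ae_restrict_of_ae indicatorConstLp_coeFn)
      rw [h2, setIntegral_indicator B.2.1]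
      simp

theorem norm_stepIntegral (c : FiniteSet μ →₀ ℝ) : ‖W.stepIntegral c‖ = ‖stepMap μ c‖ := by
  have h := W.inner_stepIntegral c c
  rw [real_inner_self_eq_norm_sq, real_inner_self_eq_norm_sq] at h
  exact (pow_left_inj₀ (norm_nonneg _) (norm_nonneg _) two_ne_zero).1 h

theorem denseRange_stepMap : DenseRange (stepMap μ) := by
  intro f
  refine Lp.induction (p := 2) (by simp)
    (motive := fun f => f ∈ closure (Set.range (stepMap μ))) ?_ ?_ isClosed_closure f
  · intro c s hs hμs
    apply subset_closure
    refine ⟨Finsupp.single ⟨s, hs, hμs⟩ c, ?_⟩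
    rw [Lp.simpleFunc.coe_indicatorConst]
    simp only [stepMap, Finsupp.linearCombination_single]
    rw [indicatorConstLp, indicatorConstLp, ← MemLp.toLp_const_smul]
    refine MemLp.toLp_congr _ _ (Filter.Eventually.of_forall fun x => ?_)
    by_cases hx : x ∈ s <;> simp [hx]
  · intro f g hf hg _ h1 h2
    have : closure (Set.range (stepMap μ)) = (LinearMap.range (stepMap μ)).topologicalClosure := by
      rw [Submodule.topologicalClosure_coe]; rfl
    rw [this] at *
    exact add_mem h1 h2

theorem scalarIntegral_indicator (A : FiniteSet μ) :
    W.scalarIntegral (indicatorConstLp 2 A.2.1 A.2.2.ne (1 : ℝ))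
      = (W.memLp A).toLp (W.toFun A.1) := by
  have h := LinearMap.extendOfNorm_eq (f := W.stepIntegral) (e := stepMap μ) denseRange_stepMap
    ⟨1, fun x => by rw [one_mul, W.norm_stepIntegral]⟩ (Finsupp.single A 1)
  simp only [stepMap, stepIntegral, Finsupp.linearCombination_single, one_smul] at h
  exact h

theorem norm_scalarIntegral (h : Lp ℝ 2 μ) : ‖W.scalarIntegral h‖ = ‖h‖ := by
  refine denseRange_stepMap.induction_on (p := fun h => ‖W.scalarIntegral h‖ = ‖h‖) h
    (isClosed_eq (by fun_prop) (by fun_prop)) fun c => ?_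
  rw [scalarIntegral, LinearMap.extendOfNorm_eq denseRange_stepMap
    ⟨1, fun x => by rw [one_mul, W.norm_stepIntegral]⟩, W.norm_stepIntegral]


/-! ### Vector-valued stochastic integration -/

variable {X : Type*} [NormedAddCommGroup X] [NormedSpace ℝ X]

/-- The random variable `Y` in `X` is a stochastic integral of `f : M → X`: the function `f` is
weakly `L²`, and `⟨Y, ξ⟩ = ∫ ⟨f, ξ⟩ dW` almost surely for every `ξ` in the dual of `X`. -/
def IsStochIntegral (f : M → X) (Y : Ω → X) : Prop :=
  AEStronglyMeasurable Y P ∧ ∀ ξ : StrongDual ℝ X,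
    ∃ h : MemLp (fun p => ξ (f p)) 2 μ, (fun ω => ξ (Y ω)) =ᵐ[P] W.scalarIntegral (h.toLp _)

open Classical in
/-- The stochastic integral `∫ f dW` of a stochastically integrable `f : M → X`; it is almost surely
unique by `IsStochIntegral.ae_eq`. (It is set to `0` if `f` is not stochastically integrable.) -/
noncomputable def stochIntegral (f : M → X) : Ω → X :=
  if h : ∃ Y, W.IsStochIntegral f Y then h.choose else 0

/-- The second moment `𝔼 ‖∫ f dW‖²`. -/
noncomputable def secondMoment (f : M → X) : ℝ≥0∞ :=
  ∫⁻ ω, ‖W.stochIntegral f ω‖ₑ ^ 2 ∂P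

/-- The norm `(𝔼 ‖∫ f dW‖²)^(1/2)`. -/
noncomputable def gaussianNorm (f : M → X) : ℝ≥0∞ :=
  W.secondMoment f ^ (1 / 2 : ℝ)

/-- `f` belongs to the algebraic tensor product `L²(M) ⊗ X`: up to a null set it is a finite sum of
functions `g ⊗ v` with `g ∈ L²(M)` and `v ∈ X`. -/
def MemL2Tensor (μ : Measure M) (f : M → X) : Prop :=
  ∃ (m : ℕ) (g : Fin m → M → ℝ) (v : Fin m → X),
    (∀ k, MemLp (g k) 2 μ) ∧ f =ᵐ[μ] fun p => ∑ k, g k p • v k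

theorem gaussianNorm_eq_eLpNorm (f : M → X) :
    W.gaussianNorm f = eLpNorm (W.stochIntegral f) 2 P := by
  rw [gaussianNorm, secondMoment, eLpNorm_eq_lintegral_rpow_enorm_toReal two_ne_zero ENNReal.ofNat_ne_top]
  simp

variable {W}

theorem IsStochIntegral.ae_eq {f : M → X} {Y Y' : Ω → X} (h : W.IsStochIntegral f Y)
    (h' : W.IsStochIntegral f Y') : Y =ᵐ[P] Y' := by
  have hd : AEStronglyMeasurable (Y - Y') P := h.1.sub h'.1
  obtain ⟨t, ht, hmem⟩ := hd.isSeparable_ae_range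
  have := ae_eq_zero_of_forall_dual_of_isSeparable ℝ ht (μ := P) (f := Y - Y') ?_ hmem
  · filter_upwards [this] with ω hω
    exact sub_eq_zero.1 hω
  · intro ξ
    obtain ⟨h1, e1⟩ := h.2 ξ
    obtain ⟨h2, e2⟩ := h'.2 ξ
    filter_upwards [e1, e2] with ω a b
    simp only [Pi.sub_apply, map_sub, Pi.zero_apply]
    rw [a, b, sub_self]

theorem IsStochIntegral.stochIntegral_ae_eq {f : M → X} {Y : Ω → X} (h : W.IsStochIntegral f Y) :
    W.stochIntegral f =ᵐ[P] Y := by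
  have hex : ∃ Y, W.IsStochIntegral f Y := ⟨Y, h⟩
  rw [stochIntegral, dif_pos hex]
  exact hex.choose_spec.ae_eq h

theorem IsStochIntegral.congr {f f' : M → X} {Y : Ω → X} (h : W.IsStochIntegral f Y)
    (hf : f =ᵐ[μ] f') : W.IsStochIntegral f' Y := by
  refine ⟨h.1, fun ξ => ?_⟩
  obtain ⟨h1, e1⟩ := h.2 ξ
  have hx : (fun p => ξ (f p)) =ᵐ[μ] fun p => ξ (f' p) := hf.mono fun p hp => by simp only [hp]
  refine ⟨h1.ae_eq hx, e1.trans ?_⟩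
  rw [MemLp.toLp_congr h1 (h1.ae_eq hx) hx]

theorem IsStochIntegral.add {f f' : M → X} {Y Y' : Ω → X} (h : W.IsStochIntegral f Y)
    (h' : W.IsStochIntegral f' Y') :
    W.IsStochIntegral (fun p => f p + f' p) (fun ω => Y ω + Y' ω) := by
  refine ⟨h.1.add h'.1, fun ξ => ?_⟩
  obtain ⟨h1, e1⟩ := h.2 ξ
  obtain ⟨h2, e2⟩ := h'.2 ξ
  have hx : (fun p => ξ (f p + f' p)) = (fun p => ξ (f p)) + fun p => ξ (f' p) := by
    ext p; simp
  have h3 : MemLp (fun p => ξ (f p + f' p)) 2 μ := hx ▸ h1.add h2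
  refine ⟨h3, ?_⟩
  have : h3.toLp _ = h1.toLp _ + h2.toLp _ := by
    rw [← MemLp.toLp_add]; exact MemLp.toLp_congr _ _ (by rw [hx])
  rw [this, map_add]
  filter_upwards [e1, e2, Lp.coeFn_add (W.scalarIntegral (h1.toLp _))
    (W.scalarIntegral (h2.toLp _))] with ω a b c
  rw [c, map_add, a, b]; rfl

theorem IsStochIntegral.smul {f : M → X} {Y : Ω → X} (h : W.IsStochIntegral f Y) (c : ℝ) :
    W.IsStochIntegral (fun p => c • f p) (fun ω => c • Y ω) := by
  refine ⟨h.1.const_smul c, fun ξ => ?_⟩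
  obtain ⟨h1, e1⟩ := h.2 ξ
  have hx : (fun p => ξ (c • f p)) = c • (fun p => ξ (f p)) := by
    ext p; simp
  have h3 : MemLp (fun p => ξ (c • f p)) 2 μ := hx ▸ h1.const_smul c
  refine ⟨h3, ?_⟩
  have : h3.toLp _ = c • h1.toLp _ := by
    rw [← MemLp.toLp_const_smul]; exact MemLp.toLp_congr _ _ (by rw [hx])
  rw [this, map_smul]
  filter_upwards [e1, Lp.coeFn_smul c (W.scalarIntegral (h1.toLp _))] with ω a b
  rw [b, map_smul, a]; rfl

variable (W) in
/-- The stochastic integral of `g ⊗ v`. -/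
noncomputable def tensorIntegral (v : X) : Lp ℝ 2 μ →L[ℝ] Lp X 2 P :=
  ((ContinuousLinearMap.toSpanSingleton ℝ v).compLpL 2 P).comp W.scalarIntegral

theorem isStochIntegral_smul_const {g : M → ℝ} (hg : MemLp g 2 μ) (v : X) :
    W.IsStochIntegral (fun p => g p • v) (W.tensorIntegral v (hg.toLp g)) := by
  refine ⟨Lp.aestronglyMeasurable _, fun ξ => ?_⟩
  have hx : (fun p => ξ (g p • v)) = (ξ v) • g := by
    ext p; simp [mul_comm]
  have h3 : MemLp (fun p => ξ (g p • v)) 2 μ := hx ▸ hg.const_smul (ξ v)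
  refine ⟨h3, ?_⟩
  have : h3.toLp _ = (ξ v) • hg.toLp g := by
    rw [← MemLp.toLp_const_smul]; exact MemLp.toLp_congr _ _ (by rw [hx])
  rw [this, map_smul]
  filter_upwards [Lp.coeFn_smul (ξ v) (W.scalarIntegral (hg.toLp g)),
    ContinuousLinearMap.coeFn_compLp (ContinuousLinearMap.toSpanSingleton ℝ v)
      (W.scalarIntegral (hg.toLp g))] with ω a b
  have b' : W.tensorIntegral v (hg.toLp g) ω = W.scalarIntegral (hg.toLp g) ω • v := b
  rw [a, b']
  simp [mul_comm]

theorem isStochIntegral_zero : W.IsStochIntegral (fun _ => (0 : X)) (fun _ => 0) := by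
  refine ⟨aestronglyMeasurable_const, fun ξ => ?_⟩
  have h0 : MemLp (fun _ : M => ξ (0 : X)) 2 μ := by simp
  refine ⟨h0, ?_⟩
  have : h0.toLp _ = 0 := by
    rw [Lp.eq_zero_iff_ae_eq_zero]
    filter_upwards [h0.coeFn_toLp] with p hp
    rw [hp]; simp
  rw [this, map_zero]
  filter_upwards [Lp.coeFn_zero ℝ 2 P] with ω b
  rw [b]; simp

theorem isStochIntegral_finsetSum {ι : Type*} (s : Finset ι) {F : ι → M → X} {T : ι → Lp X 2 P}
    (h : ∀ k, W.IsStochIntegral (F k) (T k)) :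
    W.IsStochIntegral (fun p => ∑ k ∈ s, F k p) (fun ω => ∑ k ∈ s, T k ω) := by
  classical
  induction s using Finset.induction_on with
  | empty => simpa using isStochIntegral_zero (W := W) (X := X)
  | insert k s hk ih => simpa only [Finset.sum_insert hk] using (h k).add ih

theorem isStochIntegral_sum {m : ℕ} {g : Fin m → M → ℝ} (hg : ∀ k, MemLp (g k) 2 μ)
    (v : Fin m → X) : W.IsStochIntegral (fun p => ∑ k, g k p • v k)
      (fun ω => ∑ k, W.tensorIntegral (v k) ((hg k).toLp (g k)) ω) :=
  isStochIntegral_finsetSum Finset.univ fun k => isStochIntegral_smul_const (hg k) (v k)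

theorem gaussianNorm_eq_enorm {f : M → X} {m : ℕ} {g : Fin m → M → ℝ} (hg : ∀ k, MemLp (g k) 2 μ)
    (v : Fin m → X) (hf : f =ᵐ[μ] fun p => ∑ k, g k p • v k) :
    W.gaussianNorm f = ‖∑ k, W.tensorIntegral (v k) ((hg k).toLp (g k))‖ₑ := by
  have h := ((isStochIntegral_sum (W := W) hg v).congr hf.symm).stochIntegral_ae_eq
  rw [gaussianNorm_eq_eLpNorm, Lp.enorm_def]
  refine eLpNorm_congr_ae (h.trans ?_)
  filter_upwards [Lp.coeFn_finsetSum Finset.univ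
    fun k => W.tensorIntegral (v k) ((hg k).toLp (g k))] with ω hω
  rw [hω, Finset.sum_apply]

theorem MemL2Tensor.isStochIntegral {f : M → X} (hf : MemL2Tensor μ f) :
    W.IsStochIntegral f (W.stochIntegral f) := by
  obtain ⟨m, g, v, hg, e⟩ := hf
  have hex : ∃ Y, W.IsStochIntegral f Y := ⟨_, (isStochIntegral_sum (W := W) hg v).congr e.symm⟩
  rw [stochIntegral, dif_pos hex]
  exact hex.choose_spec

theorem MemL2Tensor.add {f f' : M → X} (hf : MemL2Tensor μ f) (hf' : MemL2Tensor μ f') :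
    MemL2Tensor μ (fun p => f p + f' p) := by
  obtain ⟨m, g, v, hg, e⟩ := hf
  obtain ⟨m', g', v', hg', e'⟩ := hf'
  refine ⟨m + m', Fin.append g g', Fin.append v v', fun k => ?_, ?_⟩
  · refine Fin.addCases (fun i => ?_) (fun i => ?_) k
    · simpa using hg i
    · simpa using hg' i
  · filter_upwards [e, e'] with p h h'
    simp [Fin.sum_univ_add, h, h']

theorem MemL2Tensor.smul {f : M → X} (hf : MemL2Tensor μ f) (c : ℝ) :
    MemL2Tensor μ (fun p => c • f p) := by
  obtain ⟨m, g, v, hg, e⟩ := hf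
  refine ⟨m, g, fun k => c • v k, hg, ?_⟩
  filter_upwards [e] with p h
  simp only [h, Finset.smul_sum]
  exact Finset.sum_congr rfl fun k _ => smul_comm _ _ _

theorem MemL2Tensor.congr {f f' : M → X} (hf : MemL2Tensor μ f) (h : f =ᵐ[μ] f') :
    MemL2Tensor μ f' := by
  obtain ⟨m, g, v, hg, e⟩ := hf
  exact ⟨m, g, v, hg, h.symm.trans e⟩

theorem memL2Tensor_zero : MemL2Tensor μ (0 : M → X) :=
  ⟨0, fun _ => 0, fun _ => 0, fun k => k.elim0, Filter.Eventually.of_forall fun p => by simp⟩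

theorem indicator_sum_ae {f : M → X} {m : ℕ} {g : Fin m → M → ℝ} {v : Fin m → X}
    (e : f =ᵐ[μ] fun p => ∑ k, g k p • v k) (A : Set M) :
    A.indicator f =ᵐ[μ] fun p => ∑ k, A.indicator (g k) p • v k := by
  filter_upwards [e] with p h
  by_cases hp : p ∈ A <;> simp [hp, h]

theorem MemL2Tensor.indicator {f : M → X} (hf : MemL2Tensor μ f) {A : Set M}
    (hA : MeasurableSet A) : MemL2Tensor μ (A.indicator f) := by
  obtain ⟨m, g, v, hg, e⟩ := hf
  exact ⟨m, fun k => A.indicator (g k), v, fun k => (hg k).indicator hA, indicator_sum_ae e A⟩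

theorem gaussianNorm_add_le {f f' : M → X} (hf : MemL2Tensor μ f) (hf' : MemL2Tensor μ f') :
    W.gaussianNorm (fun p => f p + f' p) ≤ W.gaussianNorm f + W.gaussianNorm f' := by
  simp only [gaussianNorm_eq_eLpNorm]
  rw [eLpNorm_congr_ae (hf.isStochIntegral.add hf'.isStochIntegral).stochIntegral_ae_eq]
  exact eLpNorm_add_le hf.isStochIntegral.1 hf'.isStochIntegral.1 (by norm_num)

theorem gaussianNorm_smul {f : M → X} (hf : MemL2Tensor μ f) (c : ℝ) :
    W.gaussianNorm (fun p => c • f p) = ‖c‖ₑ * W.gaussianNorm f := by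
  simp only [gaussianNorm_eq_eLpNorm]
  rw [eLpNorm_congr_ae (hf.isStochIntegral.smul c).stochIntegral_ae_eq]
  exact eLpNorm_const_smul c _ 2 P

theorem gaussianNorm_ne_top {f : M → X} (hf : MemL2Tensor μ f) : W.gaussianNorm f ≠ ∞ := by
  obtain ⟨m, g, v, hg, e⟩ := hf
  rw [gaussianNorm_eq_enorm hg v e]
  exact enorm_ne_top

/-- Dominated convergence for indicators. -/
theorem tendsto_eLpNorm_indicator {ι : Type*} {l : Filter ι} [l.IsCountablyGenerated]
    {A : ι → Set M} (hA : ∀ i, MeasurableSet (A i)) (h : ∀ᵐ p ∂μ, ∀ᶠ i in l, p ∉ A i)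
    {g : M → ℝ} (hg : MemLp g 2 μ) :
    Filter.Tendsto (fun i => eLpNorm ((A i).indicator g) 2 μ) l (nhds 0) := by
  have h1 : Filter.Tendsto (fun i => ∫⁻ p, ‖(A i).indicator g p‖ₑ ^ (2 : ℝ) ∂μ) l
      (nhds (∫⁻ _, 0 ∂μ)) := by
    refine tendsto_lintegral_filter_of_dominated_convergence' (fun p => ‖g p‖ₑ ^ (2 : ℝ)) ?_ ?_ ?_ ?_
    · exact Filter.Eventually.of_forall fun i =>
        (hg.1.indicator (hA i)).enorm.pow_const _
    · refine Filter.Eventually.of_forall fun i => Filter.Eventually.of_forall fun p => ?_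
      gcongr
      by_cases hp : p ∈ A i <;> simp [hp]
    · have := hg.2
      rw [eLpNorm_lt_top_iff_lintegral_rpow_enorm_lt_top two_ne_zero ENNReal.ofNat_ne_top] at this
      simpa using this.ne
    · filter_upwards [h] with p hp
      refine tendsto_const_nhds.congr' ?_
      filter_upwards [hp] with i hi
      simp [hi]
  have h2 := h1.ennrpow_const (1 / 2)
  simp only [lintegral_zero] at h2
  rw [ENNReal.zero_rpow_of_pos (by norm_num)] at h2
  refine h2.congr fun i => ?_
  rw [eLpNorm_eq_lintegral_rpow_enorm_toReal two_ne_zero ENNReal.ofNat_ne_top]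
  simp

theorem tendsto_gaussianNorm_indicator {ι : Type*} {l : Filter ι} [l.IsCountablyGenerated]
    {A : ι → Set M} (hA : ∀ i, MeasurableSet (A i)) (h : ∀ᵐ p ∂μ, ∀ᶠ i in l, p ∉ A i)
    {f : M → X} (hf : MemL2Tensor μ f) :
    Filter.Tendsto (fun i => W.gaussianNorm ((A i).indicator f)) l (nhds 0) := by
  obtain ⟨m, g, v, hg, e⟩ := hf
  have h1 : ∀ k, Filter.Tendsto (fun i => ((hg k).indicator (hA i)).toLp ((A i).indicator (g k)))
      l (nhds 0) := by
    intro k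
    rw [tendsto_zero_iff_enorm_tendsto_zero]
    simp only [Lp.enorm_toLp]
    exact tendsto_eLpNorm_indicator hA h (hg k)
  have h2 : Filter.Tendsto (fun i => ‖∑ k, W.tensorIntegral (v k)
      (((hg k).indicator (hA i)).toLp ((A i).indicator (g k)))‖ₑ) l
      (nhds ‖∑ k, W.tensorIntegral (v k) 0‖ₑ) :=
    (tendsto_finsetSum _ fun k _ => ((W.tensorIntegral (v k)).continuous.tendsto _).comp (h1 k)).enorm
  simp only [map_zero, Finset.sum_const_zero, enorm_zero] at h2
  refine h2.congr fun i => ?_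
  rw [gaussianNorm_eq_enorm (fun k => (hg k).indicator (hA i)) v (indicator_sum_ae e (A i))]

theorem continuous_gaussianNorm_indicator {ι : Type*} [TopologicalSpace ι] [FirstCountableTopology ι]
    {A : ι → Set M} (hA : ∀ i, MeasurableSet (A i))
    (h : ∀ i₀, ∀ᵐ p ∂μ, ∀ᶠ i in nhds i₀, p ∈ A i ↔ p ∈ A i₀)
    {f : M → X} (hf : MemL2Tensor μ f) :
    Continuous (fun i => W.gaussianNorm ((A i).indicator f)) := by
  obtain ⟨m, g, v, hg, e⟩ := hf
  have h1 : ∀ k, Continuous fun i => ((hg k).indicator (hA i)).toLp ((A i).indicator (g k)) := by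
    intro k
    rw [continuous_iff_continuousAt]
    intro i₀
    rw [ContinuousAt, tendsto_iff_edist_tendsto_0]
    simp only [Lp.edist_toLp_toLp, eLpNorm_indicator_sub_indicator]
    refine tendsto_eLpNorm_indicator (fun i => (hA i).symmDiff (hA i₀)) ?_ (hg k)
    filter_upwards [h i₀] with p hp
    filter_upwards [hp] with i hi
    simp [Set.mem_symmDiff, hi]
  have h2 : Continuous fun i => ‖∑ k, W.tensorIntegral (v k)
      (((hg k).indicator (hA i)).toLp ((A i).indicator (g k)))‖ₑ :=
    (continuous_finsetSum _ fun k _ => (W.tensorIntegral (v k)).continuous.comp (h1 k)).enorm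
  refine h2.congr fun i => ?_
  rw [gaussianNorm_eq_enorm (fun k => (hg k).indicator (hA i)) v (indicator_sum_ae e (A i))]

end GaussianRandomMeasure

/-! ### Tent spaces -/

/-- The measure `dy dt / t^(n+1)` on the upper half-space `ℝⁿ × (0,∞)`, regarded as a measure on
`ℝⁿ × ℝ` which is concentrated on the upper half-space.  Accordingly functions on the upper
half-space are represented by functions on `ℝⁿ × ℝ`, whose values at `t ≤ 0` are immaterial. -/
noncomputable def halfSpaceMeasure (n : ℕ) : Measure (EuclideanSpace ℝ (Fin n) × ℝ) :=
  (volume.restrict {p | 0 < p.2}).withDensity fun p => ENNReal.ofReal ((p.2 ^ (n + 1))⁻¹)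

/-- The cone `Γ(x) = {(y,t) : |x - y| < t}`, a subset of the upper half-space. -/
def cone {n : ℕ} (x : EuclideanSpace ℝ (Fin n)) : Set (EuclideanSpace ℝ (Fin n) × ℝ) :=
  {p | ‖x - p.1‖ < p.2}

/-- The tent `{(y,t) : t > 0, B(y,t) ⊆ E}` over a set `E`. -/
def tent {n : ℕ} (E : Set (EuclideanSpace ℝ (Fin n))) : Set (EuclideanSpace ℝ (Fin n) × ℝ) :=
  {p | 0 < p.2 ∧ Metric.ball p.1 p.2 ⊆ E}

theorem measurableSet_cone {n : ℕ} (x : EuclideanSpace ℝ (Fin n)) : MeasurableSet (cone x) :=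
  (isOpen_lt (by fun_prop) (by fun_prop)).measurableSet

theorem ae_eventually_mem_cone_iff {n : ℕ} (x₀ : EuclideanSpace ℝ (Fin n)) :
    ∀ᵐ p ∂halfSpaceMeasure n, ∀ᶠ x in nhds x₀, p ∈ cone x ↔ p ∈ cone x₀ := by
  have hac : halfSpaceMeasure n ≪ volume :=
    (withDensity_absolutelyContinuous _ _).trans Measure.absolutelyContinuous_restrict
  have hnull : ∀ᵐ p : EuclideanSpace ℝ (Fin n) × ℝ, ‖x₀ - p.1‖ ≠ p.2 := by
    rw [ae_iff]
    have hm : MeasurableSet {p : EuclideanSpace ℝ (Fin n) × ℝ | ¬ ‖x₀ - p.1‖ ≠ p.2} := by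
      simp only [not_not]
      exact (isClosed_eq (by fun_prop) (by fun_prop)).measurableSet
    rw [Measure.volume_eq_prod, Measure.measure_prod_null hm]
    refine Filter.Eventually.of_forall fun y => ?_
    have : Prod.mk y ⁻¹' {p : EuclideanSpace ℝ (Fin n) × ℝ | ¬ ‖x₀ - p.1‖ ≠ p.2}
        = {‖x₀ - y‖} := by
      ext t; simp [eq_comm]
    change volume (Prod.mk y ⁻¹' {p : EuclideanSpace ℝ (Fin n) × ℝ | ¬ ‖x₀ - p.1‖ ≠ p.2}) = 0
    rw [this]
    exact measure_singleton _
  filter_upwards [hac.ae_le hnull] with p hp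
  have hc : Continuous fun x : EuclideanSpace ℝ (Fin n) => ‖x - p.1‖ := by fun_prop
  rcases lt_or_gt_of_ne hp with h | h
  · filter_upwards [hc.continuousAt.eventually_lt_const h] with x hx
    simp [cone, hx, h]
  · filter_upwards [hc.continuousAt.eventually_const_lt h] with x hx
    simp [cone, not_lt.2 hx.le, not_lt.2 h.le]

section TentSpace

open GaussianRandomMeasure

variable {n : ℕ} {Ω : Type*} [MeasurableSpace Ω] {P : Measure Ω}
  (W : GaussianRandomMeasure (halfSpaceMeasure n) P)
  {X : Type*} [NormedAddCommGroup X] [NormedSpace ℝ X]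

/-- The tent space norm `‖f‖_{T¹(X)} = ∫ (𝔼 ‖∫_{Γ(x)} f dW‖²)^(1/2) dx`, where
`∫_{Γ(x)} f dW` is the stochastic integral of `1_{Γ(x)} f`. -/
noncomputable def tentNorm (f : EuclideanSpace ℝ (Fin n) × ℝ → X) : ℝ≥0∞ :=
  ∫⁻ x : EuclideanSpace ℝ (Fin n), W.gaussianNorm ((cone x).indicator f)

variable {W}

/-- The square function `x ↦ (𝔼 ‖∫_{Γ(x)} f dW‖²)^(1/2)` is measurable; this is what makes
the tent space norm subadditive. -/
theorem aemeasurable_gaussianNorm_cone {f : EuclideanSpace ℝ (Fin n) × ℝ → X}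
    (hf : ∀ᵐ x : EuclideanSpace ℝ (Fin n),
      MemL2Tensor (halfSpaceMeasure n) ((cone x).indicator f)) :
    AEMeasurable fun x : EuclideanSpace ℝ (Fin n) => W.gaussianNorm ((cone x).indicator f) := by
  obtain ⟨t, hts, htc, htd⟩ := (Measure.dense_of_ae hf).exists_countable_dense_subset
  obtain ⟨q, hq⟩ := htc.exists_eq_range htd.nonempty
  let U : ℕ → Set (EuclideanSpace ℝ (Fin n) × ℝ) := fun k => ⋃ j ∈ Finset.range k, cone (q j)
  have hU : ∀ k, MeasurableSet (U k) := fun k =>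
    Finset.measurableSet_biUnion _ fun j _ => measurableSet_cone (q j)
  have hqg : ∀ j, MemL2Tensor (halfSpaceMeasure n) ((cone (q j)).indicator f) := fun j =>
    hts (hq ▸ Set.mem_range_self j)
  have hUf : ∀ k, MemL2Tensor (halfSpaceMeasure n) ((U k).indicator f) := by
    intro k
    induction k with
    | zero =>
      refine memL2Tensor_zero.congr (Filter.Eventually.of_forall fun p => ?_)
      simp [U]
    | succ k ih =>
      refine (ih.add ((hqg k).indicator (hU k).compl)).congr
        (Filter.Eventually.of_forall fun p => ?_)
      have hs : p ∈ U (k + 1) ↔ p ∈ U k ∨ p ∈ cone (q k) := by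
        simp only [U, Finset.mem_range, Set.mem_iUnion, exists_prop]
        constructor
        · rintro ⟨j, hj, hp⟩
          rcases Nat.lt_succ_iff_lt_or_eq.1 hj with h | h
          · exact Or.inl ⟨j, h, hp⟩
          · exact Or.inr (h ▸ hp)
        · rintro (⟨j, hj, hp⟩ | hp)
          · exact ⟨j, hj.trans (Nat.lt_succ_self k), hp⟩
          · exact ⟨k, Nat.lt_succ_self k, hp⟩
      by_cases h1 : p ∈ U k <;> by_cases h2 : p ∈ cone (q k) <;> simp [Set.indicator, hs, h1, h2]
  have hcover : ∀ᵐ p ∂halfSpaceMeasure n, ∀ᶠ k in Filter.atTop, p ∈ U k := by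
    have hpos : ∀ᵐ p ∂halfSpaceMeasure n, 0 < p.2 :=
      (withDensity_absolutelyContinuous _ _).ae_le
        (ae_restrict_mem (measurableSet_lt measurable_const measurable_snd))
    filter_upwards [hpos] with p hp
    obtain ⟨x, hx, hxt⟩ := Metric.dense_iff.1 htd p.1 p.2 hp
    rw [hq] at hxt
    obtain ⟨j, rfl⟩ := hxt
    filter_upwards [Filter.eventually_gt_atTop j] with k hk
    simp only [U, Finset.mem_range, Set.mem_iUnion, exists_prop]
    exact ⟨j, hk, by simpa [cone, dist_eq_norm] using hx⟩
  refine aemeasurable_of_tendsto_metrizable_ae Filter.atTop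
    (f := fun k x => W.gaussianNorm ((cone x).indicator ((U k).indicator f))) (fun k => ?_) ?_
  · exact (continuous_gaussianNorm_indicator (fun x => measurableSet_cone x)
      ae_eventually_mem_cone_iff (hUf k)).measurable.aemeasurable
  · filter_upwards [hf] with x hx
    have h0 : Filter.Tendsto (fun k => W.gaussianNorm ((U k)ᶜ.indicator ((cone x).indicator f)))
        Filter.atTop (nhds 0) := by
      refine tendsto_gaussianNorm_indicator (fun k => (hU k).compl) ?_ hx
      filter_upwards [hcover] with p hp
      filter_upwards [hp] with k hk
      simpa using hk
    have hcomm : ∀ k, (cone x).indicator ((U k).indicator f)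
        = (U k).indicator ((cone x).indicator f) := fun k => by
      rw [Set.indicator_indicator, Set.indicator_indicator, Set.inter_comm]
    simp only [hcomm]
    have hsum : ∀ k, (cone x).indicator f = fun p => (U k).indicator ((cone x).indicator f) p
        + (U k)ᶜ.indicator ((cone x).indicator f) p := fun k =>
      (Set.indicator_self_add_compl (U k) ((cone x).indicator f)).symm
    have hneg : ∀ k, (U k).indicator ((cone x).indicator f) = fun p => (cone x).indicator f p
        + (-1 : ℝ) • (U k)ᶜ.indicator ((cone x).indicator f) p := fun k => by
      ext p
      have := congrFun (hsum k) p
      rw [neg_smul, one_smul]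
      exact eq_add_neg_of_add_eq this.symm
    have hc : ∀ k, MemL2Tensor (halfSpaceMeasure n)
        ((U k)ᶜ.indicator ((cone x).indicator f)) := fun k => hx.indicator (hU k).compl
    have hle1 : ∀ k, W.gaussianNorm ((cone x).indicator f)
        ≤ W.gaussianNorm ((U k).indicator ((cone x).indicator f))
          + W.gaussianNorm ((U k)ᶜ.indicator ((cone x).indicator f)) := fun k => by
      conv_lhs => rw [hsum k]
      exact gaussianNorm_add_le (hx.indicator (hU k)) (hc k)
    have hle2 : ∀ k, W.gaussianNorm ((U k).indicator ((cone x).indicator f))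
        ≤ W.gaussianNorm ((cone x).indicator f)
          + W.gaussianNorm ((U k)ᶜ.indicator ((cone x).indicator f)) := fun k => by
      have h1 := gaussianNorm_add_le (W := W) hx ((hc k).smul (-1))
      rw [← hneg k, gaussianNorm_smul (hc k)] at h1
      simpa using h1
    refine tendsto_of_tendsto_of_tendsto_of_le_of_le (g := fun k => W.gaussianNorm
      ((cone x).indicator f) - W.gaussianNorm ((U k)ᶜ.indicator ((cone x).indicator f)))
      (h := fun k => W.gaussianNorm ((cone x).indicator f)
        + W.gaussianNorm ((U k)ᶜ.indicator ((cone x).indicator f))) ?_ ?_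
      (fun k => tsub_le_iff_right.2 (hle1 k)) hle2
    · simpa using ENNReal.Tendsto.sub (tendsto_const_nhds
        (x := W.gaussianNorm ((cone x).indicator f))) h0 (Or.inl (gaussianNorm_ne_top hx))
    · simpa using tendsto_const_nhds (x := W.gaussianNorm ((cone x).indicator f)).add h0

theorem tentNorm_add_le {f g : EuclideanSpace ℝ (Fin n) × ℝ → X}
    (hf : ∀ᵐ x : EuclideanSpace ℝ (Fin n),
      MemL2Tensor (halfSpaceMeasure n) ((cone x).indicator f))
    (hg : ∀ᵐ x : EuclideanSpace ℝ (Fin n),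
      MemL2Tensor (halfSpaceMeasure n) ((cone x).indicator g)) :
    tentNorm W (f + g) ≤ tentNorm W f + tentNorm W g := by
  rw [tentNorm, tentNorm, tentNorm, ← lintegral_add_left' (aemeasurable_gaussianNorm_cone hf)]
  refine lintegral_mono_ae ?_
  filter_upwards [hf, hg] with x h1 h2
  rw [Set.indicator_add']
  exact gaussianNorm_add_le h1 h2

theorem tentNorm_smul {f : EuclideanSpace ℝ (Fin n) × ℝ → X}
    (hf : ∀ᵐ x : EuclideanSpace ℝ (Fin n),
      MemL2Tensor (halfSpaceMeasure n) ((cone x).indicator f)) (c : ℝ) :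
    tentNorm W (c • f) = ‖c‖ₑ * tentNorm W f := by
  rw [tentNorm, tentNorm, ← lintegral_const_mul'' _ (aemeasurable_gaussianNorm_cone hf)]
  refine lintegral_congr_ae ?_
  filter_upwards [hf] with x h1
  have : (cone x).indicator (c • f) = fun p => c • (cone x).indicator f p :=
    Set.indicator_const_smul _ _ _
  rw [this]
  exact gaussianNorm_smul h1 c

variable (W X)

/-- The vector space of functions `f` such that `1_{Γ(x)} f ∈ L² ⊗ X` for almost every `x` and
`‖f‖_{T¹(X)} < ∞`. -/
def tentSubmodule : Submodule ℝ (EuclideanSpace ℝ (Fin n) × ℝ → X) where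
  carrier := {f | (∀ᵐ x : EuclideanSpace ℝ (Fin n),
    MemL2Tensor (halfSpaceMeasure n) ((cone x).indicator f)) ∧ tentNorm W f < ∞}
  zero_mem' := by
    have h0 : ∀ᵐ x : EuclideanSpace ℝ (Fin n), MemL2Tensor (halfSpaceMeasure n)
        ((cone x).indicator (0 : EuclideanSpace ℝ (Fin n) × ℝ → X)) :=
      Filter.Eventually.of_forall fun x => by
        rw [Set.indicator_zero']; exact memL2Tensor_zero
    refine ⟨h0, ?_⟩
    have := tentNorm_smul (W := W) h0 0
    rw [zero_smul, enorm_zero, zero_mul] at this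
    rw [this]
    exact ENNReal.zero_lt_top
  add_mem' := by
    rintro f g ⟨hf, hf'⟩ ⟨hg, hg'⟩
    refine ⟨?_, (tentNorm_add_le hf hg).trans_lt (ENNReal.add_lt_top.2 ⟨hf', hg'⟩)⟩
    filter_upwards [hf, hg] with x h1 h2
    rw [Set.indicator_add']
    exact h1.add h2
  smul_mem' := by
    rintro c f ⟨hf, hf'⟩
    refine ⟨?_, ?_⟩
    · filter_upwards [hf] with x h1
      have : (cone x).indicator (c • f) = fun p => c • (cone x).indicator f p :=
        Set.indicator_const_smul _ _ _
      rw [this]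
      exact h1.smul c
    · rw [tentNorm_smul hf]
      exact ENNReal.mul_lt_top enorm_lt_top hf'

/-- The `T¹(X)` functions, carrying the seminorm `‖·‖_{T¹(X)}`. (A separate type, because the
space of functions already carries the topology of pointwise convergence.) -/
def TentFunction : Type _ := tentSubmodule W X

namespace TentFunction

variable {W X}

instance : CoeFun (TentFunction W X) fun _ => EuclideanSpace ℝ (Fin n) × ℝ → X :=
  ⟨fun f => Subtype.val f⟩

noncomputable instance : AddCommGroup (TentFunction W X) :=
  inferInstanceAs (AddCommGroup (tentSubmodule W X))

noncomputable instance : Module ℝ (TentFunction W X) :=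
  inferInstanceAs (Module ℝ (tentSubmodule W X))

noncomputable instance : Norm (TentFunction W X) := ⟨fun f => (tentNorm W f).toReal⟩

theorem norm_def (f : TentFunction W X) : ‖f‖ = (tentNorm W f).toReal := rfl

theorem seminormedSpaceCore : SeminormedSpace.Core ℝ (TentFunction W X) where
  norm_nonneg f := ENNReal.toReal_nonneg
  norm_smul c f := by
    have h : tentNorm W (c • f : TentFunction W X) = ‖c‖ₑ * tentNorm W f :=
      tentNorm_smul (W := W) f.2.1 c
    rw [norm_def, norm_def, h, ENNReal.toReal_mul, toReal_enorm]
  norm_triangle f g := by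
    have h : tentNorm W (f + g : TentFunction W X) ≤ tentNorm W f + tentNorm W g :=
      tentNorm_add_le (W := W) f.2.1 g.2.1
    rw [norm_def, norm_def, norm_def, ← ENNReal.toReal_add f.2.2.ne g.2.2.ne]
    exact ENNReal.toReal_mono (ENNReal.add_ne_top.2 ⟨f.2.2.ne, g.2.2.ne⟩) h

noncomputable instance : SeminormedAddCommGroup (TentFunction W X) :=
  SeminormedAddCommGroup.ofCore seminormedSpaceCore

noncomputable instance : NormedSpace ℝ (TentFunction W X) where
  norm_smul_le c f := (seminormedSpaceCore.norm_smul c f).le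

end TentFunction

/-- The tent space `T¹(X)`: the completion of the space of (equivalence classes of)
`T¹(X)` functions. `UniformSpace.Completion` also identifies functions at distance zero. -/
abbrev TentSpace : Type _ := UniformSpace.Completion (TentFunction W X)

variable {X}

/-- A `T¹(X)` atom: for some ball `B` the function `a` vanishes outside the tent over `B` (which is
relatively closed in the upper half-space), `1_{Γ(x)} a ∈ L² ⊗ X` for almost every `x ∈ B`, and
`∫_B 𝔼 ‖∫_{Γ(x)} a dW‖² dx ≤ 1 / |B|`. -/
def IsTentAtom (a : EuclideanSpace ℝ (Fin n) × ℝ → X) : Prop :=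
  ∃ (c : EuclideanSpace ℝ (Fin n)) (r : ℝ), 0 < r ∧
    Function.support a ⊆ tent (Metric.ball c r) ∧
    (∀ᵐ x ∂volume.restrict (Metric.ball c r),
      MemL2Tensor (halfSpaceMeasure n) ((cone x).indicator a)) ∧
    ∫⁻ x in Metric.ball c r, W.secondMoment ((cone x).indicator a) ≤ (volume (Metric.ball c r))⁻¹

end TentSpace

universe u v

/-!
Write `γ(f) = (𝔼 ‖∫ f dW‖²)^(1/2)` and `Γ(x)` for cones. The atomic decomposition follows the
scalar scheme of Coifman, Meyer and Stein, with one essential change: without Fubini's theorem for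
square functions, the size of the pieces is controlled pointwise, over each single cone.

The probabilistic input is that restriction to a set does not increase `γ`
(`GaussianRandomMeasure.gaussianNorm_indicator_le`): stochastic integrals are jointly Gaussian, so
changing the sign of the integrand on a set does not change the law of the integral. Hence `γ` is
monotone and finitely subadditive over sets, and the square function `x ↦ γ(1_{Γ(x)} f)` has a
lower semicontinuous representative `S` (`exists_lowerSemicontinuous_squareFunction`).

The geometric input is `exists_cone_cover`. Let `O* = densityHull O` be the set of points lying in a
ball of which `O` occupies more than the fraction `64⁻ⁿ`. Then `|O*| ≤ C |O|` by the Vitali covering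
lemma, and outside the tent over `O*` every cone, also one with vertex in `O`, is covered by at most
`N` cones with vertices outside `O`, where `N` depends on the dimension only.

For `O_k = {S > 2^k}`, `k ∈ ℤ`, the two facts give `γ(1_{Γ(x)} f) ≤ N 2^(k+1)` for the part of `f`
between the tents over `O_k*` and `O_{k+1}*`, for almost every `x`. That part is split further into
parts carried by tents over balls `B_{k,j}` with `∑_j |B_{k,j}| ≤ C |O_k|` (`exists_tent_cover`);
dividing them by `λ_{k,j} = N 2^(k+1) |B_{k,j}|` gives atoms, and
`∑ λ_{k,j} ≤ C ∑_k 2^k |O_k| ≤ C ‖f‖`. The pieces are restrictions of `f` to disjoint sets which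
carry `f` almost everywhere, so the series converges almost everywhere, and unconditionally in norm
by dominated convergence. The completed space is reached by writing its elements as series of
functions (`exists_completion_decomposition`).
-/

/-! ### Stochastic integrals are jointly Gaussian; restriction is a contraction -/

namespace GaussianRandomMeasure

section Contraction

variable {M Ω : Type*} [MeasurableSpace M] [MeasurableSpace Ω] {μ : Measure M} {P : Measure Ω}
  {W : GaussianRandomMeasure μ P}

theorem scalarIntegral_sum_indicator_ae {m : ℕ} (A : Fin m → FiniteSet μ) (c : Fin m → ℝ) :
    W.scalarIntegral (∑ i, c i • indicatorConstLp 2 (A i).2.1 (A i).2.2.ne (1 : ℝ))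
      =ᵐ[P] fun ω => ∑ i, c i * W.toFun (A i).1 ω := by
  have h : W.scalarIntegral (∑ i, c i • indicatorConstLp 2 (A i).2.1 (A i).2.2.ne (1 : ℝ))
      = ∑ i, c i • (W.memLp (A i)).toLp (W.toFun (A i).1) := by
    simp [map_sum, scalarIntegral_indicator]
  rw [h]
  have h1 : ∀ᵐ ω ∂P, ∀ i, (c i • (W.memLp (A i)).toLp (W.toFun (A i).1) : Lp ℝ 2 P) ω
      = c i * W.toFun (A i).1 ω := by
    rw [ae_all_iff]
    intro i
    filter_upwards [Lp.coeFn_smul (c i) ((W.memLp (A i)).toLp (W.toFun (A i).1)),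
      (W.memLp (A i)).coeFn_toLp] with ω h1 h2
    rw [h1, Pi.smul_apply, h2, smul_eq_mul]
  filter_upwards [h1, Lp.coeFn_finsetSum Finset.univ
    fun i => (c i • (W.memLp (A i)).toLp (W.toFun (A i).1) : Lp ℝ 2 P)] with ω h1 h2
  rw [h2, Finset.sum_apply]
  exact Finset.sum_congr rfl fun i _ => h1 i

theorem norm_sq_sum_indicator {m : ℕ} (A : Fin m → FiniteSet μ) (c : Fin m → ℝ)
    (hd : Pairwise fun i j => Disjoint (A i).1 (A j).1) :
    ‖∑ i, c i • indicatorConstLp 2 (A i).2.1 (A i).2.2.ne (1 : ℝ)‖ ^ 2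
      = ∑ i, c i ^ 2 * μ.real (A i).1 := by
  rw [← real_inner_self_eq_norm_sq, sum_inner]
  refine Finset.sum_congr rfl fun i _ => ?_
  rw [inner_sum, Finset.sum_eq_single i]
  · rw [inner_smul_left, inner_smul_right, L2.real_inner_indicatorConstLp_one_indicatorConstLp_one
      (A i).2.1 (A i).2.1 (A i).2.2.ne (A i).2.2.ne]
    simp [pow_two, mul_assoc]
  · intro j _ hj
    rw [inner_smul_left, inner_smul_right, L2.real_inner_indicatorConstLp_one_indicatorConstLp_one
      (A i).2.1 (A j).2.1 (A i).2.2.ne (A j).2.2.ne, (hd hj.symm).inter_eq]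
    simp
  · simp

theorem integral_cexp_sum_indicator {m : ℕ} (A : Fin m → FiniteSet μ) (c : Fin m → ℝ)
    (hd : Pairwise fun i j => Disjoint (A i).1 (A j).1) :
    ∫ ω, Complex.exp (Complex.I * (∑ i, c i * W.toFun (A i).1 ω : ℝ)) ∂P
      = Complex.exp (-(∑ i, c i ^ 2 * μ.real (A i).1 : ℝ) / 2) := by
  have hm : ∀ i, AEMeasurable (W.toFun (A i).1) P := fun i => (W.memLp (A i)).1.aemeasurable
  have hm' : ∀ i, AEMeasurable (fun ω => c i * W.toFun (A i).1 ω) P := fun i =>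
    (hm i).const_mul _
  have hi : iIndepFun (fun i ω => c i * W.toFun (A i).1 ω) P :=
    (W.indep m (fun i => (A i).1) (fun i => (A i).2.1) (fun i => (A i).2.2) hd).comp
      (fun i x => c i * x) (fun i => by fun_prop)
  have h := congrFun (hi.charFun_map_fun_sum_eq_prod hm') 1
  rw [charFun_apply_real, integral_map (by fun_prop) (by fun_prop)] at h
  have hl : ∀ i, charFun (P.map fun ω => c i * W.toFun (A i).1 ω) 1
      = Complex.exp (-(c i ^ 2 * μ.real (A i).1 : ℝ) / 2) := by
    intro i
    have := charFun_map_mul_comp (hm i) (c i) 1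
    rw [this, (W.hasLaw (A i).1 (A i).2.1 (A i).2.2).map_eq, charFun_gaussianReal]
    congr 1
    have hr : ((μ (A i).1).toNNReal : ℂ) = (μ.real (A i).1 : ℂ) := rfl
    rw [hr]
    push_cast
    ring
  rw [Finset.prod_apply, Finset.prod_congr rfl fun i _ => hl i, ← Complex.exp_sum] at h
  convert! h using 1
  · refine integral_congr_ae (Filter.Eventually.of_forall fun ω => ?_)
    simp [mul_comm]
  · congr 1
    push_cast
    rw [← Finset.sum_div, Finset.sum_neg_distrib]

/-- The characteristic functional is continuous on `L²`, because `y ↦ exp (i y)` is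
`1`-Lipschitz. -/
theorem continuous_integral_cexp [IsProbabilityMeasure P] :
    Continuous fun Y : Lp ℝ 2 P => ∫ ω, Complex.exp (Complex.I * (Y ω : ℝ)) ∂P := by
  have hint : ∀ Y : Lp ℝ 2 P, Integrable (fun ω => Complex.exp (Complex.I * (Y ω : ℝ))) P := by
    intro Y
    have hY := Lp.aestronglyMeasurable Y
    refine Integrable.of_bound (C := 1) (by fun_prop)
      (Filter.Eventually.of_forall fun ω => ?_)
    rw [mul_comm, Complex.norm_exp_ofReal_mul_I]
  refine LipschitzWith.continuous (K := 1) (LipschitzWith.of_dist_le_mul fun Y Z => ?_)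
  rw [dist_eq_norm, dist_eq_norm, NNReal.coe_one, one_mul, ← integral_sub (hint Y) (hint Z)]
  have hYZ : Integrable (Y - Z : Lp ℝ 2 P) P := (Lp.memLp (Y - Z)).integrable (by norm_num)
  have h1 : ∀ᵐ ω ∂P, ‖Complex.exp (Complex.I * (Y ω : ℝ)) - Complex.exp (Complex.I * (Z ω : ℝ))‖
      ≤ ‖(Y - Z : Lp ℝ 2 P) ω‖ := by
    filter_upwards [Lp.coeFn_sub Y Z] with ω hω
    rw [hω, Pi.sub_apply]
    have e : Complex.exp (Complex.I * (Y ω : ℝ)) - Complex.exp (Complex.I * (Z ω : ℝ))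
        = Complex.exp ((Z ω : ℝ) * Complex.I)
          * (Complex.exp (Complex.I * (Y ω - Z ω : ℝ)) - 1) := by
      rw [mul_sub, ← Complex.exp_add, mul_one]
      congr 2
      · push_cast; ring
      · ring
    rw [e, norm_mul, Complex.norm_exp_ofReal_mul_I, one_mul]
    exact Real.norm_exp_I_mul_ofReal_sub_one_le
  calc ‖∫ ω, (Complex.exp (Complex.I * (Y ω : ℝ)) - Complex.exp (Complex.I * (Z ω : ℝ))) ∂P‖
      ≤ ∫ ω, ‖(Y - Z : Lp ℝ 2 P) ω‖ ∂P := norm_integral_le_of_norm_le hYZ.norm h1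
    _ = (eLpNorm (Y - Z : Lp ℝ 2 P) 1 P).toReal := by
        rw [eLpNorm_one_eq_lintegral_enorm, integral_norm_eq_lintegral_enorm hYZ.1]
    _ ≤ (eLpNorm (Y - Z : Lp ℝ 2 P) 2 P).toReal :=
        ENNReal.toReal_mono (Lp.memLp _).2.ne
          (eLpNorm_le_eLpNorm_of_exponent_le (by norm_num) (Lp.memLp (Y - Z)).1)
    _ = ‖Y - Z‖ := (Lp.norm_def _).symm

/-- A simple function is a combination of indicators of disjoint sets, so its stochastic integral
is a sum of independent Gaussian variables; density carries the formula over to `L²`. -/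
theorem integral_cexp_scalarIntegral [IsProbabilityMeasure P] (g : Lp ℝ 2 μ) :
    ∫ ω, Complex.exp (Complex.I * (W.scalarIntegral g ω : ℝ)) ∂P
      = Complex.exp (-(‖g‖ ^ 2 : ℝ) / 2) := by
  refine (Lp.simpleFunc.denseRange (E := ℝ) (μ := μ) (p := 2) (by simp)).induction_on
    (p := fun g => ∫ ω, Complex.exp (Complex.I * (W.scalarIntegral g ω : ℝ)) ∂P
      = Complex.exp (-(‖g‖ ^ 2 : ℝ) / 2)) g
    (isClosed_eq (continuous_integral_cexp.comp W.scalarIntegral.continuous) (by fun_prop)) ?_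
  intro s
  let F := Lp.simpleFunc.toSimpleFunc s
  have hF : MemLp F 2 μ := Lp.simpleFunc.memLp s
  let T : Finset ℝ := F.range.erase 0
  let e : Fin T.card ≃ T := T.equivFin.symm
  let A : Fin T.card → FiniteSet μ := fun i => ⟨F ⁻¹' {(e i : ℝ)}, F.measurableSet_fiber _,
    F.measure_preimage_lt_top_of_memLp two_ne_zero (by simp) hF _ (Finset.ne_of_mem_erase (e i).2)⟩
  have hd : Pairwise fun i j => Disjoint (A i).1 (A j).1 := by
    intro i j hij
    refine Disjoint.preimage _ (Set.disjoint_singleton.2 fun h => hij ?_)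
    exact e.injective (Subtype.ext h)
  have hs : (s : Lp ℝ 2 μ)
      = ∑ i, (e i : ℝ) • indicatorConstLp 2 (A i).2.1 (A i).2.2.ne (1 : ℝ) := by
    apply Lp.ext
    have h1 : ∀ᵐ x ∂μ, ∀ i, ((e i : ℝ) • indicatorConstLp 2 (A i).2.1 (A i).2.2.ne (1 : ℝ)
        : Lp ℝ 2 μ) x = (e i : ℝ) * (A i).1.indicator (fun _ => 1) x := by
      rw [ae_all_iff]
      intro i
      filter_upwards [Lp.coeFn_smul (e i : ℝ) (indicatorConstLp 2 (A i).2.1 (A i).2.2.ne (1 : ℝ)),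
        indicatorConstLp_coeFn (p := 2) (hs := (A i).2.1) (hμs := (A i).2.2.ne) (c := (1 : ℝ))]
        with x h1 h2
      rw [h1, Pi.smul_apply, h2, smul_eq_mul]
    filter_upwards [h1, Lp.simpleFunc.toSimpleFunc_eq_toFun s, Lp.coeFn_finsetSum Finset.univ
      fun i => ((e i : ℝ) • indicatorConstLp 2 (A i).2.1 (A i).2.2.ne (1 : ℝ) : Lp ℝ 2 μ)]
      with x h1 h2 h3
    rw [h3, Finset.sum_apply, Finset.sum_congr rfl fun i _ => h1 i]
    refine h2.symm.trans ?_
    rw [e.sum_comp fun y : T => (y : ℝ) * (F ⁻¹' {(y : ℝ)}).indicator (fun _ => (1 : ℝ)) x,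
      T.sum_coe_sort fun y : ℝ => y * (F ⁻¹' {y}).indicator (fun _ => (1 : ℝ)) x]
    by_cases hx : F x = 0
    · rw [Finset.sum_eq_zero]
      · exact hx
      · intro y hy
        rw [Set.indicator_of_notMem, mul_zero]
        intro hxy
        exact Finset.ne_of_mem_erase hy (hxy.symm.trans hx)
    · rw [Finset.sum_eq_single (F x)]
      · simp [F]
      · intro y _ hy
        rw [Set.indicator_of_notMem, mul_zero]
        exact fun hxy => hy hxy.symm
      · intro h
        exact (h (Finset.mem_erase.2 ⟨hx, F.mem_range_self x⟩)).elim
  rw [hs, norm_sq_sum_indicator A _ hd, ← integral_cexp_sum_indicator (W := W) A _ hd]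
  refine integral_congr_ae ?_
  filter_upwards [scalarIntegral_sum_indicator_ae (W := W) A fun i => (e i : ℝ)] with ω hω
  rw [hω]

/-- Stochastic integrals are jointly Gaussian: their joint law only depends on the norms of the
linear combinations of the integrands, that is, on their Gram matrix. -/
theorem map_scalarIntegral_congr [IsProbabilityMeasure P] {m : ℕ} {g g' : Fin m → Lp ℝ 2 μ}
    (h : ∀ s : Fin m → ℝ, ‖∑ k, s k • g k‖ = ‖∑ k, s k • g' k‖) :
    P.map (fun ω => WithLp.toLp 2 fun k => W.scalarIntegral (g k) ω)
      = P.map (fun ω => WithLp.toLp 2 fun k => W.scalarIntegral (g' k) ω) := by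
  have hm : ∀ g : Fin m → Lp ℝ 2 μ,
      AEMeasurable (fun ω => WithLp.toLp 2 fun k => W.scalarIntegral (g k) ω) P := fun g =>
    (WithLp.measurable_toLp 2 _).comp_aemeasurable
      (aemeasurable_pi_lambda _ fun k => (Lp.aestronglyMeasurable _).aemeasurable)
  have key : ∀ (g : Fin m → Lp ℝ 2 μ) (s : EuclideanSpace ℝ (Fin m)),
      charFun (P.map (fun ω => WithLp.toLp 2 fun k => W.scalarIntegral (g k) ω)) s
        = Complex.exp (-(‖∑ k, s k • g k‖ ^ 2 : ℝ) / 2) := by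
    intro g s
    rw [charFun_apply, integral_map (hm g) (by fun_prop), ← integral_cexp_scalarIntegral (W := W)]
    refine integral_congr_ae ?_
    have h1 : ∀ᵐ ω ∂P, ∀ k, (s k • W.scalarIntegral (g k) : Lp ℝ 2 P) ω
        = s k * W.scalarIntegral (g k) ω := by
      rw [ae_all_iff]
      exact fun k => Lp.coeFn_smul (s k) (W.scalarIntegral (g k))
    filter_upwards [h1, Lp.coeFn_finsetSum Finset.univ
      fun k => (s k • W.scalarIntegral (g k) : Lp ℝ 2 P)] with ω h1 h2
    have h3 : W.scalarIntegral (∑ k, s k • g k) ω = ∑ k, s k * W.scalarIntegral (g k) ω := by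
      rw [map_sum]
      simp only [map_smul]
      rw [h2, Finset.sum_apply]
      exact Finset.sum_congr rfl fun k _ => h1 k
    rw [h3, PiLp.inner_apply, mul_comm]
    simp
  have := Measure.isProbabilityMeasure_map (hm g)
  have := Measure.isProbabilityMeasure_map (hm g')
  refine Measure.ext_of_charFun (funext fun s => ?_)
  rw [key, key, h]

variable {X : Type*} [NormedAddCommGroup X] [NormedSpace ℝ X]

theorem enorm_sum_tensorIntegral_congr [IsProbabilityMeasure P] {m : ℕ} {g g' : Fin m → Lp ℝ 2 μ} (v : Fin m → X)
    (h : ∀ s : Fin m → ℝ, ‖∑ k, s k • g k‖ = ‖∑ k, s k • g' k‖) :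
    ‖∑ k, W.tensorIntegral (v k) (g k)‖ₑ = ‖∑ k, W.tensorIntegral (v k) (g' k)‖ₑ := by
  have key : ∀ g : Fin m → Lp ℝ 2 μ, ‖∑ k, W.tensorIntegral (v k) (g k)‖ₑ
      = eLpNorm (fun y : EuclideanSpace ℝ (Fin m) => ∑ k, y k • v k) 2
        (P.map (fun ω => WithLp.toLp 2 fun k => W.scalarIntegral (g k) ω)) := by
    intro g
    have hm : AEMeasurable (fun ω => WithLp.toLp 2 fun k => W.scalarIntegral (g k) ω) P :=
      (WithLp.measurable_toLp 2 _).comp_aemeasurable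
        (aemeasurable_pi_lambda _ fun k => (Lp.aestronglyMeasurable _).aemeasurable)
    rw [eLpNorm_map_measure (Continuous.aestronglyMeasurable (by fun_prop)) hm, Lp.enorm_def]
    refine eLpNorm_congr_ae ?_
    have h1 : ∀ᵐ ω ∂P, ∀ k, W.tensorIntegral (v k) (g k) ω = W.scalarIntegral (g k) ω • v k := by
      rw [ae_all_iff]
      exact fun k => ContinuousLinearMap.coeFn_compLp
        (ContinuousLinearMap.toSpanSingleton ℝ (v k)) (W.scalarIntegral (g k))
    filter_upwards [h1, Lp.coeFn_finsetSum Finset.univ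
      fun k => W.tensorIntegral (v k) (g k)] with ω h1 h2
    rw [h2, Finset.sum_apply]
    exact Finset.sum_congr rfl fun k _ => h1 k
  rw [key, key, map_scalarIntegral_congr h]

/-- Restriction to a set is a contraction. Changing the sign of the integrand off `A` does not
change the law of the stochastic integral, and `1_A f` is the mean of `f` and of the function with
the changed sign. -/
theorem gaussianNorm_indicator_le [IsProbabilityMeasure P] {f : M → X} (hf : MemL2Tensor μ f) {A : Set M}
    (hA : MeasurableSet A) : W.gaussianNorm (A.indicator f) ≤ W.gaussianNorm f := by
  obtain ⟨m, g, v, hg, e⟩ := hf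
  have hgA := fun k => (hg k).indicator hA
  have hgB := fun k => (hg k).indicator hA.compl
  rw [gaussianNorm_eq_enorm hgA v (indicator_sum_ae e A), gaussianNorm_eq_enorm hg v e]
  set a := fun k => (hgA k).toLp (A.indicator (g k))
  set b := fun k => (hgB k).toLp (Aᶜ.indicator (g k))
  have hab : ∀ k, (hg k).toLp (g k) = a k + b k := by
    intro k
    rw [← MemLp.toLp_add]
    exact MemLp.toLp_congr _ _ (Filter.Eventually.of_forall fun x =>
      (congrFun (Set.indicator_self_add_compl A (g k)) x).symm)
  have horth : ∀ j k, inner ℝ (a j) (b k) = 0 := by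
    intro j k
    rw [L2.inner_def]
    refine integral_eq_zero_of_ae ?_
    filter_upwards [(hgA j).coeFn_toLp, (hgB k).coeFn_toLp] with x h1 h2
    simp only [a, b]
    rw [h1, h2]
    by_cases hx : x ∈ A <;> simp [hx]
  have hnorm : ∀ s : Fin m → ℝ, ‖∑ k, s k • (a k + b k)‖ = ‖∑ k, s k • (a k - b k)‖ := by
    intro s
    have ho : inner ℝ (∑ k, s k • a k) (∑ k, s k • b k) = (0 : ℝ) := by
      simp [sum_inner, inner_sum, inner_smul_left, inner_smul_right, horth]
    simp only [smul_add, smul_sub, Finset.sum_add_distrib, Finset.sum_sub_distrib]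
    have h1 := norm_add_sq_eq_norm_sq_add_norm_sq_of_inner_eq_zero _ _ ho
    have h2 := norm_sub_sq_eq_norm_sq_add_norm_sq_real ho
    rw [← h2] at h1
    exact (mul_self_inj (norm_nonneg _) (norm_nonneg _)).1 h1
  have hflip := enorm_sum_tensorIntegral_congr (W := W) v hnorm
  simp only [hab]
  have hmean : ∑ k, W.tensorIntegral (v k) (a k) = (1 / 2 : ℝ) •
      (∑ k, W.tensorIntegral (v k) (a k + b k) + ∑ k, W.tensorIntegral (v k) (a k - b k)) := by
    rw [← Finset.sum_add_distrib, Finset.smul_sum]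
    refine Finset.sum_congr rfl fun k _ => ?_
    rw [map_add, map_sub]
    module
  rw [hmean, enorm_smul]
  refine (mul_le_mul_right (enorm_add_le _ _) _).trans ?_
  rw [← hflip, ← two_mul, ← mul_assoc]
  have : ‖(1 / 2 : ℝ)‖ₑ * 2 = 1 := by
    rw [Real.enorm_eq_ofReal (by norm_num), ← ENNReal.ofReal_ofNat 2,
      ← ENNReal.ofReal_mul (by norm_num)]
    norm_num
  rw [this, one_mul]

theorem MemL2Tensor.aestronglyMeasurable {f : M → X} (hf : MemL2Tensor μ f) :
    AEStronglyMeasurable f μ := by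
  obtain ⟨m, g, v, hg, e⟩ := hf
  refine AEStronglyMeasurable.congr ?_ e.symm
  exact Finset.aestronglyMeasurable_fun_sum _ fun k _ => (hg k).1.smul_const (v k)

theorem gaussianNorm_congr {f f' : M → X} (hf : MemL2Tensor μ f) (h : f =ᵐ[μ] f') :
    W.gaussianNorm f = W.gaussianNorm f' := by
  rw [gaussianNorm_eq_eLpNorm, gaussianNorm_eq_eLpNorm]
  exact eLpNorm_congr_ae (hf.isStochIntegral.congr h).stochIntegral_ae_eq.symm

/-- The seminorm `γ` is definite, since the scalar stochastic integral is an isometry. -/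
theorem MemL2Tensor.ae_eq_zero_of_gaussianNorm_eq_zero {f : M → X} (hf : MemL2Tensor μ f)
    (h : W.gaussianNorm f = 0) : f =ᵐ[μ] 0 := by
  obtain ⟨t, ht, hmem⟩ := hf.aestronglyMeasurable.isSeparable_ae_range
  refine ae_eq_zero_of_forall_dual_of_isSeparable ℝ ht (fun ξ => ?_) hmem
  rw [gaussianNorm_eq_eLpNorm, eLpNorm_eq_zero_iff hf.isStochIntegral.1 two_ne_zero] at h
  obtain ⟨hξ, e⟩ := hf.isStochIntegral (W := W).2 ξ
  have h0 : W.scalarIntegral (hξ.toLp _) = 0 := by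
    rw [Lp.eq_zero_iff_ae_eq_zero]
    filter_upwards [e, h] with ω h1 h2
    rw [← h1, h2]
    simp
  have h1 : hξ.toLp _ = 0 := by
    rw [← norm_eq_zero, ← W.norm_scalarIntegral, h0, norm_zero]
  rw [Lp.eq_zero_iff_ae_eq_zero] at h1
  filter_upwards [h1, hξ.coeFn_toLp] with p h1 h2
  rw [← h2, h1]

theorem secondMoment_eq_gaussianNorm_sq (f : M → X) :
    W.secondMoment f = W.gaussianNorm f ^ 2 := by
  rw [gaussianNorm, ← ENNReal.rpow_natCast, ← ENNReal.rpow_mul]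
  norm_num

theorem gaussianNorm_zero : W.gaussianNorm (0 : M → X) = 0 := by
  have h := gaussianNorm_smul (W := W) (memL2Tensor_zero (μ := μ) (X := X)) 0
  simpa [Pi.zero_def] using h

theorem gaussianNorm_indicator_mono [IsProbabilityMeasure P] {f : M → X} {A B : Set M} (hAB : A ⊆ B)
    (hA : MeasurableSet A) (hf : MemL2Tensor μ (B.indicator f)) :
    W.gaussianNorm (A.indicator f) ≤ W.gaussianNorm (B.indicator f) := by
  have h := gaussianNorm_indicator_le (W := W) hf hA
  rwa [Set.indicator_indicator, Set.inter_eq_left.2 hAB] at h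

theorem MemL2Tensor.indicator_mono {f : M → X} {A B : Set M} (hAB : A ⊆ B)
    (hA : MeasurableSet A) (hf : MemL2Tensor μ (B.indicator f)) :
    MemL2Tensor μ (A.indicator f) := by
  have h := hf.indicator hA
  rwa [Set.indicator_indicator, Set.inter_eq_left.2 hAB] at h

/-- Subadditivity over a finite cover. -/
theorem gaussianNorm_indicator_le_sum [IsProbabilityMeasure P] {ι : Type*} {f : M → X} (hf : MemL2Tensor μ f)
    (s : Finset ι) {B : ι → Set M} (hB : ∀ i, MeasurableSet (B i)) {A : Set M}
    (hA : MeasurableSet A) (hAB : A ⊆ ⋃ i ∈ s, B i) :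
    W.gaussianNorm (A.indicator f) ≤ ∑ i ∈ s, W.gaussianNorm ((B i).indicator f) := by
  classical
  induction s using Finset.induction_on generalizing A with
  | empty =>
    have : A = ∅ := by simpa using hAB
    simp [this, gaussianNorm_zero, ← Pi.zero_def]
  | insert i s hi ih =>
    rw [Finset.sum_insert hi]
    have h1 : A.indicator f
        = fun p => (A ∩ B i).indicator f p + (A \ B i).indicator f p := by
      ext p
      by_cases hp : p ∈ A <;> by_cases hq : p ∈ B i <;> simp [hp, hq]
    rw [h1]
    refine (gaussianNorm_add_le (hf.indicator (hA.inter (hB i)))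
      (hf.indicator (hA.diff (hB i)))).trans (add_le_add ?_ (ih (hA.diff (hB i)) ?_))
    · exact gaussianNorm_indicator_mono Set.inter_subset_right (hA.inter (hB i))
        (hf.indicator (hB i))
    · rintro p ⟨hp, hq⟩
      have := hAB hp
      simp only [Finset.mem_insert, Set.mem_iUnion, exists_prop] at this ⊢
      obtain ⟨j, rfl | hj, hpj⟩ := this
      · exact (hq hpj).elim
      · exact ⟨j, hj, hpj⟩

end Contraction

end GaussianRandomMeasure

/-! ### Geometry of cones and tents -/

section Geometry

variable {n : ℕ}

theorem measurableSet_tent {E : Set (EuclideanSpace ℝ (Fin n))} :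
    MeasurableSet (tent E) := by
  have h : tent E = {p | 0 < p.2} ∩ ⋂ z ∈ Eᶜ, {p | p.2 ≤ dist z p.1} := by
    ext p
    simp only [tent, Set.mem_ofPred_eq, Set.mem_inter_iff, Set.mem_iInter, Set.mem_compl_iff]
    refine and_congr_right fun _ => ⟨fun h z hz => ?_, fun h z hz => ?_⟩
    · by_contra! hlt
      exact hz (h hlt)
    · by_contra hE
      exact (h z hE).not_gt hz
  rw [h]
  refine (isOpen_lt (by fun_prop) (by fun_prop)).measurableSet.inter (IsClosed.measurableSet ?_)
  exact isClosed_biInter fun z _ => isClosed_le (by fun_prop) (by fun_prop)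

theorem tent_mono {E F : Set (EuclideanSpace ℝ (Fin n))} (h : E ⊆ F) : tent E ⊆ tent F :=
  fun _ hp => ⟨hp.1, hp.2.trans h⟩

/-- The points lying in a ball of which `O` occupies more than the fraction `64⁻ⁿ`; in other words
a superlevel set of the uncentered maximal function of the indicator of `O`. -/
def densityHull (O : Set (EuclideanSpace ℝ (Fin n))) : Set (EuclideanSpace ℝ (Fin n)) :=
  ⋃ q ∈ {q : EuclideanSpace ℝ (Fin n) × ℝ | 0 < q.2 ∧
    volume (Metric.ball q.1 q.2) < 64 ^ n * volume (O ∩ Metric.ball q.1 q.2)}, Metric.ball q.1 q.2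

theorem isOpen_densityHull (O : Set (EuclideanSpace ℝ (Fin n))) : IsOpen (densityHull O) :=
  isOpen_biUnion fun _ _ => Metric.isOpen_ball

theorem densityHull_mono {O O' : Set (EuclideanSpace ℝ (Fin n))} (h : O ⊆ O') :
    densityHull O ⊆ densityHull O' := by
  refine Set.biUnion_subset_biUnion_left fun q hq => ⟨hq.1, hq.2.trans_le ?_⟩
  gcongr

theorem volume_ball_mul (x y : EuclideanSpace ℝ (Fin n)) {a r : ℝ} (ha : 0 < a) :
    volume (Metric.ball x (a * r)) = ENNReal.ofReal a ^ n * volume (Metric.ball y r) := by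
  rw [Measure.addHaar_ball_mul_of_pos volume x ha r, Measure.addHaar_ball_center volume y,
    finrank_euclideanSpace_fin, ENNReal.ofReal_pow ha.le]

/-- Balls of bounded volume have bounded radius. -/
theorem exists_radius_bound (hn : 1 ≤ n) {V : ℝ≥0∞} (hV : V ≠ ∞) :
    ∃ R : ℝ, ∀ (x : EuclideanSpace ℝ (Fin n)) (r : ℝ), volume (Metric.ball x r) ≤ V → r ≤ R := by
  have h1 : volume (Metric.ball (0 : EuclideanSpace ℝ (Fin n)) 1) ≠ 0 :=
    (Metric.measure_ball_pos _ _ one_pos).ne'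
  refine ⟨max 1 (V / volume (Metric.ball (0 : EuclideanSpace ℝ (Fin n)) 1)).toReal,
    fun x r h => ?_⟩
  rcases le_or_gt r 1 with hr | hr
  · exact hr.trans (le_max_left _ _)
  · refine le_trans ?_ (le_max_right _ _)
    have h2 := volume_ball_mul x 0 (a := r) (r := 1) (by linarith)
    rw [mul_one] at h2
    rw [h2] at h
    have h3 : ENNReal.ofReal r ≤ ENNReal.ofReal r ^ n :=
      le_self_pow₀ (by simpa using hr.le) (by lia)
    have h4 : ENNReal.ofReal r ≤ V / volume (Metric.ball (0 : EuclideanSpace ℝ (Fin n)) 1) := by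
      rw [ENNReal.le_div_iff_mul_le (Or.inl h1) (Or.inl measure_ball_lt_top.ne)]
      exact (mul_le_mul_left h3 _).trans h
    exact (ENNReal.ofReal_le_iff_le_toReal (ENNReal.div_ne_top hV h1)).1 h4

theorem subset_densityHull (hn : 1 ≤ n) {O : Set (EuclideanSpace ℝ (Fin n))} (hO : IsOpen O) :
    O ⊆ densityHull O := by
  intro x hx
  obtain ⟨r, hr, hxr⟩ := Metric.isOpen_iff.1 hO x hx
  refine Set.mem_biUnion (x := (x, r)) ⟨hr, ?_⟩ (Metric.mem_ball_self hr)
  simp only [Set.inter_eq_right.2 hxr]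
  have h0 : volume (Metric.ball x r) ≠ 0 := (Metric.measure_ball_pos _ _ hr).ne'
  conv_lhs => rw [← one_mul (volume (Metric.ball x r))]
  exact ENNReal.mul_lt_mul_left h0 measure_ball_lt_top.ne (one_lt_pow₀ (by norm_num) (by lia))

/-- The weak type `(1,1)` bound of the maximal function, from the Vitali covering lemma. -/
theorem volume_densityHull_le (hn : 1 ≤ n) (O : Set (EuclideanSpace ℝ (Fin n))) :
    volume (densityHull O) ≤ 5 ^ n * 64 ^ n * volume O := by
  have : Nontrivial (EuclideanSpace ℝ (Fin n)) := by
    have : Nonempty (Fin n) := ⟨⟨0, hn⟩⟩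
    infer_instance
  rcases eq_or_ne (volume O) ∞ with hO | hO
  · rw [hO, ENNReal.mul_top (by positivity)]
    exact le_top
  set t := {q : EuclideanSpace ℝ (Fin n) × ℝ | 0 < q.2 ∧
    volume (Metric.ball q.1 q.2) < 64 ^ n * volume (O ∩ Metric.ball q.1 q.2)}
  obtain ⟨R, hR⟩ := exists_radius_bound hn (V := 64 ^ n * volume O)
    (ENNReal.mul_ne_top (by simp) hO)
  have htR : ∀ q ∈ t, q.2 ≤ R := fun q hq => hR q.1 q.2 <| hq.2.le.trans <| by
    gcongr; exact Set.inter_subset_left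
  obtain ⟨u, hut, hd, hcov⟩ := Vitali.exists_disjoint_subfamily_covering_enlargement_closedBall
    t Prod.fst Prod.snd R htR 5 (by norm_num)
  have hdb : u.PairwiseDisjoint fun q => Metric.ball q.1 q.2 :=
    hd.mono fun q => Metric.ball_subset_closedBall
  have huc : u.Countable := hdb.countable_of_isOpen (fun _ _ => Metric.isOpen_ball)
    fun q hq => ⟨q.1, Metric.mem_ball_self (hut hq).1⟩
  have hsub : densityHull O ⊆ ⋃ q ∈ u, Metric.closedBall q.1 (5 * q.2) := by
    intro x hx
    obtain ⟨q, hq, hxq⟩ := Set.mem_iUnion₂.1 hx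
    obtain ⟨b, hb, hqb⟩ := hcov q hq
    exact Set.mem_biUnion hb (hqb (Metric.ball_subset_closedBall hxq))
  have := huc.to_subtype
  calc volume (densityHull O) ≤ volume (⋃ q ∈ u, Metric.closedBall q.1 (5 * q.2)) :=
        measure_mono hsub
    _ ≤ ∑' q : u, volume (Metric.closedBall q.1.1 (5 * q.1.2)) := measure_biUnion_le _ huc _
    _ ≤ ∑' q : u, 5 ^ n * 64 ^ n * volume (O ∩ Metric.ball q.1.1 q.1.2) := by
        refine ENNReal.tsum_le_tsum fun q => ?_
        rw [Measure.addHaar_closedBall_eq_addHaar_ball,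
          volume_ball_mul _ q.1.1 (by norm_num : (0 : ℝ) < 5), ENNReal.ofReal_ofNat, mul_assoc]
        gcongr
        exact (hut q.2).2.le
    _ = 5 ^ n * 64 ^ n * ∑' q : u, volume.restrict O (Metric.ball q.1.1 q.1.2) := by
        rw [ENNReal.tsum_mul_left]
        congr 2 with q
        rw [Measure.restrict_apply measurableSet_ball, Set.inter_comm]
    _ = 5 ^ n * 64 ^ n * volume.restrict O (⋃ q ∈ u, Metric.ball q.1 q.2) := by
        rw [measure_biUnion huc hdb fun _ _ => measurableSet_ball]
    _ ≤ 5 ^ n * 64 ^ n * volume O := by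
        refine mul_le_mul_right ((measure_mono (Set.subset_univ _)).trans ?_) _
        rw [Measure.restrict_apply_univ]

/-- A finite net of the unit sphere, in homogeneous form. -/
theorem exists_direction_net (n : ℕ) : ∃ T : Finset (EuclideanSpace ℝ (Fin n)),
    (∀ u ∈ T, ‖u‖ ≤ 1) ∧ ∀ v : EuclideanSpace ℝ (Fin n), ∃ u ∈ T, ‖‖v‖ • u - v‖ ≤ ‖v‖ / 4 := by
  classical
  obtain ⟨T, hT, hfin, hcov⟩ := Metric.finite_approx_of_totallyBounded
    (isCompact_closedBall (0 : EuclideanSpace ℝ (Fin n)) 1).totallyBounded (1 / 4) (by norm_num)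
  refine ⟨hfin.toFinset, fun u hu => by simpa using hT (hfin.mem_toFinset.1 hu), fun v => ?_⟩
  obtain ⟨u, hu, hvu⟩ := Set.mem_iUnion₂.1
    (hcov (show ‖v‖⁻¹ • v ∈ Metric.closedBall (0 : EuclideanSpace ℝ (Fin n)) 1 by
      rw [mem_closedBall_zero_iff, norm_smul, norm_inv, norm_norm]
      exact inv_mul_le_one))
  refine ⟨u, hfin.mem_toFinset.2 hu, ?_⟩
  rcases eq_or_ne v 0 with rfl | hv
  · simp
  · have hv' : ‖v‖ ≠ 0 := norm_ne_zero_iff.2 hv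
    have e : ‖v‖ • u - v = ‖v‖ • (u - ‖v‖⁻¹ • v) := by
      rw [smul_sub, smul_smul, mul_inv_cancel₀ hv', one_smul]
    rw [e, norm_smul, norm_norm]
    rw [Metric.mem_ball, dist_comm, dist_eq_norm] at hvu
    nlinarith [norm_nonneg v]

/-- The geometric heart of the matter. A cone is covered, outside the tent over the density hull
of `O`, by boundedly many cones with vertices outside `O`. If `x` lies at distance `d` from the
complement of the hull, `O` has small density in `B(x, 2d)`, so a vertex outside `O` can be found
near each of the points `x + (d/4)u`, where `u` runs over a finite net of directions. A point
`(y,t)` of the cone at `x` outside the tent has `t > d/2`, and it lies in the cone whose vertex is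
displaced from `x` roughly in the direction of `y - x`. -/
theorem exists_cone_cover (hn : 1 ≤ n) : ∃ N : ℕ, 1 ≤ N ∧
    ∀ (O : Set (EuclideanSpace ℝ (Fin n))), IsOpen O → ∀ x : EuclideanSpace ℝ (Fin n),
      ∃ S : Finset (EuclideanSpace ℝ (Fin n)), S.card ≤ N ∧ (∀ z ∈ S, z ∉ O) ∧
        cone x \ tent (densityHull O) ⊆ ⋃ z ∈ S, cone z := by
  classical
  obtain ⟨T, hT1, hT⟩ := exists_direction_net n
  refine ⟨T.card + 1, by lia, fun O hO x => ?_⟩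
  by_cases hxO : x ∈ O
  swap
  · exact ⟨{x}, by simp, by simpa using hxO, by simp⟩
  rcases (densityHull O)ᶜ.eq_empty_or_nonempty with hemp | hne
  · refine ⟨∅, by simp, by simp, fun p hp => (hp.2 ⟨(norm_nonneg _).trans_lt hp.1, ?_⟩).elim⟩
    rw [Set.compl_empty_iff.1 hemp]
    exact Set.subset_univ _
  have hcl : IsClosed (densityHull O)ᶜ := (isOpen_densityHull O).isClosed_compl
  set d := Metric.infDist x (densityHull O)ᶜ with hd
  have hdpos : 0 < d := (hcl.notMem_iff_infDist_pos hne).1 fun h => h (subset_densityHull hn hO hxO)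
  obtain ⟨z, hz, hzd⟩ := hcl.exists_infDist_eq_dist hne x
  have hdens : 64 ^ n * volume (O ∩ Metric.ball x (2 * d)) ≤ volume (Metric.ball x (2 * d)) := by
    by_contra! hlt
    refine hz (Set.mem_biUnion (x := (x, 2 * d)) ⟨by positivity, hlt⟩ ?_)
    rw [Metric.mem_ball, dist_comm, ← hzd]
    linarith
  have hvert : ∀ u ∈ T, ∃ w ∈ Metric.ball (x + (d / 4) • u) (d / 16), w ∉ O := by
    intro u hu
    by_contra! hsub
    have hb : Metric.ball (x + (d / 4) • u) (d / 16) ⊆ O ∩ Metric.ball x (2 * d) := by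
      refine Set.subset_inter hsub (Metric.ball_subset_ball' ?_)
      rw [dist_eq_norm, add_sub_cancel_left, norm_smul, Real.norm_of_nonneg (by positivity)]
      nlinarith [hT1 u hu]
    have h2 : volume (Metric.ball x (2 * d))
        = 32 ^ n * volume (Metric.ball (x + (d / 4) • u) (d / 16)) := by
      rw [show 2 * d = 32 * (d / 16) by ring,
        volume_ball_mul x (x + (d / 4) • u) (by norm_num : (0 : ℝ) < 32), ENNReal.ofReal_ofNat]
    have h0 : volume (Metric.ball (x + (d / 4) • u) (d / 16)) ≠ 0 :=
      (Metric.measure_ball_pos _ _ (by positivity)).ne'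
    have h3 : (64 : ℝ≥0∞) ^ n * volume (Metric.ball (x + (d / 4) • u) (d / 16))
        ≤ 32 ^ n * volume (Metric.ball (x + (d / 4) • u) (d / 16)) :=
      (mul_le_mul_right (measure_mono hb) _).trans (hdens.trans h2.le)
    refine h3.not_gt (ENNReal.mul_lt_mul_left h0 measure_ball_lt_top.ne ?_)
    have : (32 : ℝ≥0) ^ n < 64 ^ n := pow_lt_pow_left₀ (by norm_num) (by positivity) (by lia)
    exact_mod_cast this
  choose! w hw hwO using hvert
  refine ⟨T.image w, Finset.card_image_le.trans (by lia), ?_, ?_⟩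
  · intro z hz
    obtain ⟨u, hu, rfl⟩ := Finset.mem_image.1 hz
    exact hwO u hu
  rintro ⟨y, t⟩ ⟨hp, hpt⟩
  have hp' : ‖x - y‖ < t := hp
  have ht : 0 < t := (norm_nonneg _).trans_lt hp'
  have htd : d < 2 * t := by
    obtain ⟨b, hb, hbO⟩ : ∃ b ∈ Metric.ball y t, b ∉ densityHull O := by
      by_contra! h
      exact hpt ⟨ht, h⟩
    have h1 : d ≤ dist x b := Metric.infDist_le_dist_of_mem hbO
    have h2 := dist_triangle x y b
    rw [Metric.mem_ball, dist_comm] at hb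
    rw [← dist_eq_norm] at hp'
    linarith
  obtain ⟨u, hu, huy⟩ := hT (y - x)
  refine Set.mem_biUnion (Finset.mem_image_of_mem w hu) ?_
  change ‖w u - y‖ < t
  have hs : ‖y - x‖ < t := by rwa [norm_sub_rev]
  set s := ‖y - x‖
  have he : ‖w u - (x + (d / 4) • u)‖ < d / 16 := by
    have := hw u hu
    rwa [Metric.mem_ball, dist_eq_norm] at this
  have hs0 : 0 ≤ s := norm_nonneg _
  rcases le_or_gt (d / 4) s with hds | hds
  · have hspos : 0 < s := by linarith
    have e : w u - y = (w u - (x + (d / 4) • u)) + (d / 4 / s) • (s • u - (y - x))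
        - (1 - d / 4 / s) • (y - x) := by
      rw [smul_sub, smul_smul, div_mul_cancel₀ _ hspos.ne']
      module
    have hq : d / 4 / s ≤ 1 := (div_le_one hspos).2 hds
    have hq0 : 0 ≤ d / 4 / s := by positivity
    have h1 : ‖(d / 4 / s) • (s • u - (y - x))‖ ≤ d / 16 := by
      rw [norm_smul, Real.norm_of_nonneg hq0]
      calc d / 4 / s * ‖s • u - (y - x)‖ ≤ d / 4 / s * (s / 4) := by gcongr
        _ = d / 16 := by field_simp; norm_num
    have h2 : ‖(1 - d / 4 / s) • (y - x)‖ = s - d / 4 := by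
      rw [norm_smul, Real.norm_of_nonneg (by linarith), sub_mul, one_mul]
      congr 1
      exact div_mul_cancel₀ _ hspos.ne'
    rw [e]
    have h3 := norm_sub_le (w u - (x + (d / 4) • u) + (d / 4 / s) • (s • u - (y - x)))
      ((1 - d / 4 / s) • (y - x))
    have h4 := norm_add_le (w u - (x + (d / 4) • u)) ((d / 4 / s) • (s • u - (y - x)))
    linarith
  · have e : w u - y = (w u - (x + (d / 4) • u)) + ((d / 4 - s) • u + (s • u - (y - x))) := by
      module
    have h1 : ‖(d / 4 - s) • u‖ ≤ d / 4 - s := by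
      rw [norm_smul, Real.norm_of_nonneg (by linarith)]
      nlinarith [hT1 u hu]
    rw [e]
    have h3 := norm_add_le (w u - (x + (d / 4) • u)) ((d / 4 - s) • u + (s • u - (y - x)))
    have h4 := norm_add_le ((d / 4 - s) • u) (s • u - (y - x))
    linarith

/-- The tent over an open set `O` of finite measure is decomposed over the vertical strips
`Q j × (0, ∞)` into parts lying in tents over balls of comparable total measure. Unused indices
have radius `0`. -/
theorem exists_tent_cover (hn : 1 ≤ n) {O : Set (EuclideanSpace ℝ (Fin n))} (hO : IsOpen O)
    (hOV : volume O ≠ ∞) :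
    ∃ (c : ℕ → EuclideanSpace ℝ (Fin n)) (r : ℕ → ℝ) (Q : ℕ → Set (EuclideanSpace ℝ (Fin n))),
      (∀ j, MeasurableSet (Q j)) ∧ Pairwise (fun i j => Disjoint (Q i) (Q j)) ∧
      (O ⊆ ⋃ j, Q j) ∧
      (∀ j, ∀ p ∈ tent O, p.1 ∈ Q j → p ∈ tent (Metric.ball (c j) (r j))) ∧
      ∑' j, volume (Metric.ball (c j) (r j)) ≤ 12 ^ n * volume O := by
  classical
  have : Nontrivial (EuclideanSpace ℝ (Fin n)) := by
    have : Nonempty (Fin n) := ⟨⟨0, hn⟩⟩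
    infer_instance
  have : NoncompactSpace (EuclideanSpace ℝ (Fin n)) := NormedSpace.noncompactSpace ℝ _
  have hne : Oᶜ.Nonempty := by
    rw [Set.nonempty_compl]
    rintro rfl
    exact hOV (measure_univ_of_isAddLeftInvariant volume)
  obtain ⟨R, hR⟩ := exists_radius_bound hn hOV
  let c : ℕ → EuclideanSpace ℝ (Fin n) := TopologicalSpace.denseSeq _
  let d : EuclideanSpace ℝ (Fin n) → ℝ := fun y => Metric.infDist y Oᶜ
  have hball : ∀ y, Metric.ball y (d y) ⊆ O := fun y =>
    (Metric.disjoint_ball_infDist (s := Oᶜ)).subset_compl_right.trans (compl_compl O).subset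
  have hpos : ∀ y ∈ O, 0 < d y := fun y hy =>
    (hO.isClosed_compl.notMem_iff_infDist_pos hne).1 fun h => h hy
  obtain ⟨u, hut, hd, hcov⟩ := Vitali.exists_disjoint_subfamily_covering_enlargement_closedBall
    {j | c j ∈ O} c (fun j => d (c j) / 2) (R / 2)
    (fun j _ => by have := hR _ _ (measure_mono (hball (c j))); linarith) 5 (by norm_num)
  let ρ : ℕ → ℝ := fun j => if j ∈ u then d (c j) / 2 else 0
  let Q : ℕ → Set (EuclideanSpace ℝ (Fin n)) := fun j => Metric.closedBall (c j) (5 * ρ j)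
  have hvol : ∀ j, volume (Metric.ball (c j) (12 * ρ j))
      = 12 ^ n * volume (Metric.ball (c j) (ρ j)) := fun j => by
    rw [volume_ball_mul _ (c j) (by norm_num : (0 : ℝ) < 12), ENNReal.ofReal_ofNat]
  have hQ : ∀ y ∈ O, ∃ j ∈ u, y ∈ Metric.closedBall (c j) (5 * (d (c j) / 2)) := by
    intro y hy
    obtain ⟨j, hj⟩ := (TopologicalSpace.denseRange_denseSeq
      (EuclideanSpace ℝ (Fin n))).exists_dist_lt y (ε := d y / 4) (by linarith [hpos y hy])
    have h1 : d y ≤ d (c j) + dist y (c j) := Metric.infDist_le_infDist_add_dist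
    have hjO : c j ∈ O := by
      refine hball y ?_
      rw [Metric.mem_ball, dist_comm]
      exact hj.trans (by linarith [hpos y hy])
    obtain ⟨b, hb, hjb⟩ := hcov j hjO
    refine ⟨b, hb, hjb ?_⟩
    rw [Metric.mem_closedBall]
    change dist y (c j) < d y / 4 at hj
    linarith [hpos y hy]
  refine ⟨c, fun j => 12 * ρ j, disjointed (fun j => if j ∈ u then Q j else ∅), ?_, ?_, ?_, ?_, ?_⟩
  · refine MeasurableSet.disjointed fun j => ?_
    by_cases hj : j ∈ u
    · simpa [hj, Q] using measurableSet_closedBall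
    · simp [hj]
  · exact disjoint_disjointed _
  · rw [iUnion_disjointed]
    intro y hy
    obtain ⟨j, hj, hyj⟩ := hQ y hy
    refine Set.mem_iUnion.2 ⟨j, ?_⟩
    simpa [hj, Q, ρ] using hyj
  · rintro j ⟨y, t⟩ ⟨ht, hb⟩ hyj
    have hyj' := disjointed_subset _ _ hyj
    by_cases hj : j ∈ u
    swap
    · simp [hj] at hyj'
    simp only [hj, if_true, Q, ρ, Metric.mem_closedBall] at hyj'
    refine ⟨ht, ?_⟩
    have htd : t ≤ d y := by
      refine (Metric.le_infDist hne).2 fun z hz => ?_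
      by_contra! hlt
      exact hz (hb (by rwa [Metric.mem_ball, dist_comm]))
    have h1 : d y ≤ d (c j) + dist y (c j) := Metric.infDist_le_infDist_add_dist
    refine Metric.ball_subset_ball' ?_
    simp only [hj, if_true, ρ]
    linarith
  · simp only [hvol]
    rw [ENNReal.tsum_mul_left, ← measure_iUnion]
    · gcongr
      refine Set.iUnion_subset fun j => ?_
      by_cases hj : j ∈ u
      · refine (Metric.ball_subset_ball ?_).trans (hball (c j))
        simp only [hj, if_true, ρ]
        linarith [hpos (c j) (hut hj)]
      · simp [hj, ρ]
    · intro i j hij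
      by_cases hi : i ∈ u
      swap
      · simp [Function.onFun, hi, ρ]
      by_cases hj : j ∈ u
      swap
      · simp [Function.onFun, hj, ρ]
      simp only [Function.onFun, hi, hj, if_true, ρ]
      exact (hd hi hj hij).mono Metric.ball_subset_closedBall Metric.ball_subset_closedBall
    · exact fun _ => measurableSet_ball

end Geometry

/-! ### The square function and its level sets -/

section Decomposition

open GaussianRandomMeasure

variable {n : ℕ} {Ω : Type*} [MeasurableSpace Ω] {P : Measure Ω}
  {W : GaussianRandomMeasure (halfSpaceMeasure n) P}
  {X : Type*} [NormedAddCommGroup X] [NormedSpace ℝ X]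

theorem ae_halfSpaceMeasure_pos : ∀ᵐ p ∂halfSpaceMeasure n, 0 < p.2 :=
  (withDensity_absolutelyContinuous _ _).ae_le
    (ae_restrict_mem (measurableSet_lt measurable_const measurable_snd))

/-- Countably many cones with vertices outside a null set exhaust the upper half-space. -/
theorem exists_dense_vertices {p : EuclideanSpace ℝ (Fin n) → Prop} (hp : ∀ᵐ x, p x) :
    ∃ q : ℕ → EuclideanSpace ℝ (Fin n), (∀ j, p (q j)) ∧
      ∀ z : EuclideanSpace ℝ (Fin n) × ℝ, 0 < z.2 → ∃ j, z ∈ cone (q j) := by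
  obtain ⟨t, hts, htc, htd⟩ := (Measure.dense_of_ae hp).exists_countable_dense_subset
  obtain ⟨q, hq⟩ := htc.exists_eq_range htd.nonempty
  refine ⟨q, fun j => hts (hq ▸ Set.mem_range_self j), fun z hz => ?_⟩
  obtain ⟨x, hx, hxt⟩ := Metric.dense_iff.1 htd z.1 z.2 hz
  rw [hq] at hxt
  obtain ⟨j, rfl⟩ := hxt
  exact ⟨j, by simpa [cone, dist_eq_norm] using hx⟩

/-- Finite unions of cones exhaust the half-space by sets over which `f` is in `L² ⊗ X`. -/
theorem exists_exhaustion {f : EuclideanSpace ℝ (Fin n) × ℝ → X}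
    (hf : ∀ᵐ x : EuclideanSpace ℝ (Fin n),
      MemL2Tensor (halfSpaceMeasure n) ((cone x).indicator f)) :
    ∃ U : ℕ → Set (EuclideanSpace ℝ (Fin n) × ℝ), (∀ k, MeasurableSet (U k)) ∧
      (∀ k, MemL2Tensor (halfSpaceMeasure n) ((U k).indicator f)) ∧
      ∀ p, 0 < p.2 → ∀ᶠ k in Filter.atTop, p ∈ U k := by
  obtain ⟨q, hqf, hq⟩ := exists_dense_vertices hf
  have hU : ∀ k, MeasurableSet (Set.accumulate (fun j => cone (q j)) k) := fun k =>
    MeasurableSet.biUnion (Set.to_countable _) fun j _ => measurableSet_cone (q j)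
  refine ⟨Set.accumulate fun j => cone (q j), hU, fun k => ?_, fun p hp => ?_⟩
  · induction k with
    | zero => simpa [Set.accumulate_def] using hqf 0
    | succ k ih =>
      refine (ih.add ((hqf (k + 1)).indicator (hU k).compl)).congr
        (Filter.Eventually.of_forall fun p => ?_)
      by_cases h1 : p ∈ Set.accumulate (fun j => cone (q j)) k <;>
        by_cases h2 : p ∈ cone (q (k + 1)) <;> simp [Set.indicator, h1, h2]
  · obtain ⟨j, hj⟩ := hq p hp
    filter_upwards [Filter.eventually_ge_atTop j] with k hk
    exact Set.mem_accumulate.2 ⟨j, hk, hj⟩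

/-- A bound over all members of an exhaustion is a bound over the whole set. -/
theorem gaussianNorm_indicator_le_of_forall_inter {f : EuclideanSpace ℝ (Fin n) × ℝ → X}
    {U : ℕ → Set (EuclideanSpace ℝ (Fin n) × ℝ)} (hU : ∀ k, MeasurableSet (U k))
    (hU' : ∀ p, 0 < p.2 → ∀ᶠ k in Filter.atTop, p ∈ U k)
    {A : Set (EuclideanSpace ℝ (Fin n) × ℝ)}
    (hAf : MemL2Tensor (halfSpaceMeasure n) (A.indicator f)) {b : ℝ≥0∞}
    (hb : ∀ k, W.gaussianNorm ((A ∩ U k).indicator f) ≤ b) :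
    W.gaussianNorm (A.indicator f) ≤ b := by
  have h0 : Filter.Tendsto (fun k => W.gaussianNorm ((U k)ᶜ.indicator (A.indicator f)))
      Filter.atTop (nhds 0) := by
    refine tendsto_gaussianNorm_indicator (fun k => (hU k).compl) ?_ hAf
    filter_upwards [ae_halfSpaceMeasure_pos] with p hp
    filter_upwards [hU' p hp] with k hk
    simpa using hk
  have h1 : Filter.Tendsto (fun k => b + W.gaussianNorm ((U k)ᶜ.indicator (A.indicator f)))
      Filter.atTop (nhds b) := by simpa using h0.const_add b
  refine ge_of_tendsto' h1 fun k => ?_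
  have h2 : A.indicator f = fun p => (U k).indicator (A.indicator f) p
      + (U k)ᶜ.indicator (A.indicator f) p :=
    (Set.indicator_self_add_compl (U k) (A.indicator f)).symm
  conv_lhs => rw [h2]
  refine (gaussianNorm_add_le (hAf.indicator (hU k)) (hAf.indicator (hU k).compl)).trans ?_
  gcongr
  rw [Set.indicator_indicator, Set.inter_comm]
  exact hb k

/-- The square function `x ↦ γ(1_{Γ(x)} f)` has a lower semicontinuous representative, which also
controls `f` over cones whose vertices lie in the exceptional null set. -/
theorem exists_lowerSemicontinuous_squareFunction [IsProbabilityMeasure P]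
    {f : EuclideanSpace ℝ (Fin n) × ℝ → X}
    (hf : ∀ᵐ x : EuclideanSpace ℝ (Fin n),
      MemL2Tensor (halfSpaceMeasure n) ((cone x).indicator f)) :
    ∃ S : EuclideanSpace ℝ (Fin n) → ℝ≥0∞, LowerSemicontinuous S ∧
      (∀ᵐ x, S x = W.gaussianNorm ((cone x).indicator f)) ∧
      ∀ (s : Finset (EuclideanSpace ℝ (Fin n))) (A : Set (EuclideanSpace ℝ (Fin n) × ℝ)),
        MeasurableSet A → MemL2Tensor (halfSpaceMeasure n) (A.indicator f) →
        A ⊆ ⋃ z ∈ s, cone z → W.gaussianNorm (A.indicator f) ≤ ∑ z ∈ s, S z := by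
  obtain ⟨U, hU, hUf, hU'⟩ := exists_exhaustion hf
  refine ⟨fun x => ⨆ k, W.gaussianNorm ((cone x).indicator ((U k).indicator f)), ?_, ?_, ?_⟩
  · exact lowerSemicontinuous_iSup fun k => (continuous_gaussianNorm_indicator
      (fun x => measurableSet_cone x) ae_eventually_mem_cone_iff (hUf k)).lowerSemicontinuous
  · filter_upwards [hf] with x hx
    refine le_antisymm (iSup_le fun k => ?_) ?_
    · rw [Set.indicator_indicator]
      exact gaussianNorm_indicator_mono Set.inter_subset_left
        ((measurableSet_cone x).inter (hU k)) hx
    · refine gaussianNorm_indicator_le_of_forall_inter hU hU' hx fun k => ?_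
      rw [← Set.indicator_indicator]
      exact le_iSup (fun k => W.gaussianNorm ((cone x).indicator ((U k).indicator f))) k
  · intro s A hA hAf hAs
    refine gaussianNorm_indicator_le_of_forall_inter hU hU' hAf fun k => ?_
    rw [← Set.indicator_indicator]
    refine (gaussianNorm_indicator_le_sum (hUf k) s (fun z => measurableSet_cone z) hA hAs).trans
      (Finset.sum_le_sum fun z _ => ?_)
    exact le_iSup (fun k => W.gaussianNorm ((cone z).indicator ((U k).indicator f))) k

theorem eq_zero_of_forall_le_mul_zpow {a b : ℝ≥0∞} (hb : b ≠ ∞)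
    (h : ∀ k : ℤ, a ≤ b * 2 ^ k) : a = 0 := by
  have h1 : Filter.Tendsto (fun j : ℕ => b * (2⁻¹ : ℝ≥0∞) ^ j) Filter.atTop (nhds (b * 0)) :=
    ENNReal.Tendsto.const_mul (ENNReal.tendsto_pow_atTop_nhds_zero_of_lt_one (by simp))
      (Or.inr hb)
  rw [mul_zero] at h1
  refine le_zero_iff.1 (ge_of_tendsto' h1 fun j => (h (-j)).trans_eq ?_)
  rw [ENNReal.zpow_neg, zpow_natCast, ENNReal.inv_pow]

theorem tsum_zpow_of_lt_le (s : ℝ≥0∞) :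
    ∑' k : ℤ, (if (2 : ℝ≥0∞) ^ k < s then (2 : ℝ≥0∞) ^ k else 0) ≤ 2 * s := by
  rcases eq_or_ne s 0 with rfl | hs
  · simp
  rcases eq_or_ne s ∞ with rfl | hs'
  · simp
  obtain ⟨m, hm1, hm2⟩ := ENNReal.exists_mem_Ioc_zpow hs hs' (y := 2) (by norm_num) (by norm_num)
  have h1 : ∀ k : ℤ, (if (2 : ℝ≥0∞) ^ k < s then (2 : ℝ≥0∞) ^ k else 0)
      ≤ if k ≤ m then (2 : ℝ≥0∞) ^ k else 0 := by
    intro k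
    split_ifs with h h'
    · exact le_rfl
    · exact ((ENNReal.zpow_le_of_le (by norm_num) (by lia : m + 1 ≤ k)).not_gt
        (h.trans_le hm2)).elim
    · exact zero_le
    · exact le_rfl
  refine (ENNReal.tsum_le_tsum h1).trans ?_
  have hinj : Function.Injective fun j : ℕ => m - (j : ℤ) := fun i j h => by
    simpa using h
  rw [← hinj.tsum_eq]
  · have h2 : ∀ j : ℕ, (if m - (j : ℤ) ≤ m then (2 : ℝ≥0∞) ^ (m - (j : ℤ)) else 0)
        = 2 ^ m * 2⁻¹ ^ j := by
      intro j
      rw [if_pos (by lia), sub_eq_add_neg, ENNReal.zpow_add (by norm_num) (by norm_num),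
        ENNReal.zpow_neg, zpow_natCast, ENNReal.inv_pow]
    simp only [h2]
    rw [ENNReal.tsum_mul_left, ENNReal.tsum_geometric, ENNReal.one_sub_inv_two, inv_inv, mul_comm]
    gcongr
  · intro k hk
    have hkm : k ≤ m := by
      by_contra h
      simp [h] at hk
    exact ⟨(m - k).toNat, by simp only; lia⟩

/-- The dyadic layer cake bound. -/
theorem tsum_zpow_mul_measure_lt_le {α : Type*} [MeasurableSpace α] {ν : Measure α}
    {S : α → ℝ≥0∞} (hS : Measurable S) :
    ∑' k : ℤ, 2 ^ k * ν {x | 2 ^ k < S x} ≤ 2 * ∫⁻ x, S x ∂ν := by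
  have h1 : ∀ k : ℤ, (2 : ℝ≥0∞) ^ k * ν {x | 2 ^ k < S x}
      = ∫⁻ x, (if (2 : ℝ≥0∞) ^ k < S x then (2 : ℝ≥0∞) ^ k else 0) ∂ν := by
    intro k
    have hk : MeasurableSet {x | (2 : ℝ≥0∞) ^ k < S x} := measurableSet_lt measurable_const hS
    rw [← lintegral_indicator_const hk]
    exact lintegral_congr fun x => by simp [Set.indicator_apply]
  simp only [h1]
  rw [← lintegral_tsum fun k => (Measurable.ite (measurableSet_lt measurable_const hS)
    measurable_const measurable_const).aemeasurable, ← lintegral_const_mul _ hS]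
  exact lintegral_mono fun x => tsum_zpow_of_lt_le (S x)

/-- The half-space is cut along the tents over the density hulls of the level sets
`{S > 2^k}` of the square function and along the strips of `exists_tent_cover`. The numbers `M i` are the values `N 2^(k+1)`: the part of
`f` between the `k`-th and the `(k+1)`-st tent has norm at most `N 2^(k+1)` over every cone. -/
theorem exists_pieces [IsProbabilityMeasure P] (hn : 1 ≤ n) {N : ℕ} (hN : 1 ≤ N)
    (hcone : ∀ (O : Set (EuclideanSpace ℝ (Fin n))), IsOpen O → ∀ x : EuclideanSpace ℝ (Fin n),
      ∃ s : Finset (EuclideanSpace ℝ (Fin n)), s.card ≤ N ∧ (∀ z ∈ s, z ∉ O) ∧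
        cone x \ tent (densityHull O) ⊆ ⋃ z ∈ s, cone z)
    {f : EuclideanSpace ℝ (Fin n) × ℝ → X}
    (hf : ∀ᵐ x : EuclideanSpace ℝ (Fin n),
      MemL2Tensor (halfSpaceMeasure n) ((cone x).indicator f)) (hf' : tentNorm W f ≠ ∞) :
    ∃ (D : ℕ → Set (EuclideanSpace ℝ (Fin n) × ℝ)) (c : ℕ → EuclideanSpace ℝ (Fin n))
      (r : ℕ → ℝ) (M : ℕ → ℝ≥0∞), (∀ i, MeasurableSet (D i)) ∧
      Pairwise (fun i j => Disjoint (D i) (D j)) ∧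
      (∀ᵐ p ∂halfSpaceMeasure n, f p ≠ 0 → p ∈ ⋃ i, D i) ∧
      (∀ i, D i ⊆ tent (Metric.ball (c i) (r i))) ∧ (∀ i, M i ≠ 0 ∧ M i ≠ ∞) ∧
      (∀ i, ∀ᵐ x, W.gaussianNorm ((cone x ∩ D i).indicator f) ≤ M i) ∧
      ∑' i, M i * volume (Metric.ball (c i) (r i))
        ≤ N * (4 * 12 ^ n * 5 ^ n * 64 ^ n) * tentNorm W f := by
  obtain ⟨S, hSl, hSf, hSA⟩ := exists_lowerSemicontinuous_squareFunction (W := W) hf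
  have hSint : ∫⁻ x, S x = tentNorm W f := lintegral_congr_ae hSf
  let O : ℤ → Set (EuclideanSpace ℝ (Fin n)) := fun k => {x | 2 ^ k < S x}
  have hO : ∀ k, IsOpen (O k) := fun k => hSl.isOpen_preimage _
  have hOanti : ∀ {k l : ℤ}, k ≤ l → O l ⊆ O k := fun h x hx =>
    (ENNReal.zpow_le_of_le (by norm_num) h).trans_lt hx
  have hOsum : ∑' k : ℤ, 2 ^ k * volume (O k) ≤ 2 * tentNorm W f :=
    hSint ▸ tsum_zpow_mul_measure_lt_le hSl.measurable
  have hOfin : ∀ k, volume (O k) ≠ ∞ := by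
    intro k
    have h1 := (ENNReal.le_tsum k).trans hOsum
    intro h
    rw [h, ENNReal.mul_top (ENNReal.zpow_pos (by norm_num) (by norm_num) k).ne', top_le_iff] at h1
    exact ENNReal.mul_ne_top (by norm_num) hf' h1
  have hpow0 : ∀ k : ℤ, (2 : ℝ≥0∞) ^ k ≠ 0 := fun k =>
    (ENNReal.zpow_pos (by norm_num) (by norm_num) k).ne'
  have hpowtop : ∀ k : ℤ, (2 : ℝ≥0∞) ^ k ≠ ∞ := fun k =>
    (ENNReal.zpow_lt_top (by norm_num) (by norm_num) k).ne
  let E : ℤ → Set (EuclideanSpace ℝ (Fin n)) := fun k => densityHull (O k)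
  have hE : ∀ k, IsOpen (E k) := fun k => isOpen_densityHull _
  have hEvol : ∀ k, volume (E k) ≤ 5 ^ n * 64 ^ n * volume (O k) := fun k =>
    volume_densityHull_le hn _
  have hEfin : ∀ k, volume (E k) ≠ ∞ := fun k =>
    ne_top_of_le_ne_top (ENNReal.mul_ne_top (ENNReal.mul_ne_top (by simp) (by simp)) (hOfin k))
      (hEvol k)
  have hEanti : ∀ {k l : ℤ}, k ≤ l → tent (E l) ⊆ tent (E k) := fun h =>
    tent_mono (densityHull_mono (hOanti h))
  have hbound : ∀ (k : ℤ) (A : Set (EuclideanSpace ℝ (Fin n) × ℝ)), MeasurableSet A →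
      Disjoint A (tent (E k)) → ∀ᵐ x, W.gaussianNorm ((cone x ∩ A).indicator f) ≤ N * 2 ^ k := by
    intro k A hA hAE
    filter_upwards [hf] with x hx
    obtain ⟨s, hs, hsO, hcov⟩ := hcone (O k) (hO k) x
    have hm : MeasurableSet (cone x ∩ A) := (measurableSet_cone x).inter hA
    refine (hSA s (cone x ∩ A) hm (hx.indicator_mono Set.inter_subset_left hm)
      (fun p hp => hcov ⟨hp.1, hAE.notMem_of_mem_left hp.2⟩)).trans ?_
    -- The vertices `z` lie outside `{S > 2^k}`.
    calc ∑ z ∈ s, S z ≤ ∑ z ∈ s, (2 : ℝ≥0∞) ^ k :=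
          Finset.sum_le_sum fun z hz => not_lt.1 (hsO z hz)
      _ = s.card * 2 ^ k := by rw [Finset.sum_const, nsmul_eq_mul]
      _ ≤ N * 2 ^ k := by gcongr
  -- The part of `f` outside all the tents has norm at most `N 2^k` over every cone, for all `k`;
  -- let `k → -∞`.
  have hcover : ∀ᵐ p ∂halfSpaceMeasure n, f p ≠ 0 → ∃ k, p ∈ tent (E k) := by
    have hZ : MeasurableSet (⋃ k, tent (E k))ᶜ :=
      (MeasurableSet.iUnion fun k => measurableSet_tent).compl
    have h1 : ∀ᵐ x : EuclideanSpace ℝ (Fin n),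
        (cone x ∩ (⋃ k, tent (E k))ᶜ).indicator f =ᵐ[halfSpaceMeasure n] 0 := by
      have h2 : ∀ᵐ x : EuclideanSpace ℝ (Fin n), ∀ k : ℤ,
          W.gaussianNorm ((cone x ∩ (⋃ k, tent (E k))ᶜ).indicator f) ≤ N * 2 ^ k := by
        rw [ae_all_iff]
        exact fun k => hbound k _ hZ
          (disjoint_compl_left.mono_right (Set.subset_iUnion (fun k => tent (E k)) k))
      filter_upwards [hf, h2] with x hx h2
      exact (hx.indicator_mono Set.inter_subset_left
        ((measurableSet_cone x).inter hZ)).ae_eq_zero_of_gaussianNorm_eq_zero (W := W)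
        (eq_zero_of_forall_le_mul_zpow (by simp) h2)
    obtain ⟨q, hq, hqc⟩ := exists_dense_vertices h1
    filter_upwards [ae_all_iff.2 hq, ae_halfSpaceMeasure_pos] with p hp hpos hfp
    by_contra hnot
    obtain ⟨j, hj⟩ := hqc p hpos
    have := hp j
    rw [Set.indicator_of_mem (show p ∈ cone (q j) ∩ (⋃ k, tent (E k))ᶜ from
      ⟨hj, by simpa using hnot⟩)] at this
    exact hfp this
  -- The measures of the hulls tend to `0` as `k → ∞`, so no ball lies in all of them.
  have hexit : ∀ p : EuclideanSpace ℝ (Fin n) × ℝ, 0 < p.2 → ∃ k, p ∉ tent (E k) := by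
    intro p hp
    by_contra! hall
    have h0 : volume (Metric.ball p.1 p.2) = 0 := by
      refine eq_zero_of_forall_le_mul_zpow (b := 5 ^ n * 64 ^ n * (2 * tentNorm W f))
        (ENNReal.mul_ne_top (ENNReal.mul_ne_top (by simp) (by simp))
          (ENNReal.mul_ne_top (by norm_num) hf')) fun k => ?_
      refine (measure_mono (hall (-k)).2).trans ((hEvol (-k)).trans ?_)
      rw [mul_assoc (5 ^ n * 64 ^ n)]
      refine mul_le_mul_right ?_ _
      have h1 := (ENNReal.le_tsum (-k)).trans hOsum
      rw [ENNReal.zpow_neg, mul_comm, ← div_eq_mul_inv] at h1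
      exact (ENNReal.div_le_iff (hpow0 k) (hpowtop k)).1 h1
    exact (Metric.measure_ball_pos _ _ hp).ne' h0
  choose c r Q hQm hQd hQc hQt hQv using fun k => exists_tent_cover hn (hE k) (hEfin k)
  let D : ℤ × ℕ → Set (EuclideanSpace ℝ (Fin n) × ℝ) := fun i =>
    (tent (E i.1) \ tent (E (i.1 + 1))) ∩ Prod.fst ⁻¹' Q i.1 i.2
  have hDm : ∀ i, MeasurableSet (D i) := fun i =>
    (measurableSet_tent.diff measurableSet_tent).inter (measurable_fst (hQm i.1 i.2))
  have hDlt : ∀ i j : ℤ × ℕ, i.1 < j.1 → Disjoint (D i) (D j) := fun i j hij =>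
    Set.disjoint_left.2 fun p hi hj => hi.1.2 (hEanti (by lia) hj.1.1)
  have hDd : ∀ i j, i ≠ j → Disjoint (D i) (D j) := by
    rintro ⟨k, i⟩ ⟨l, j⟩ hne
    rcases lt_trichotomy k l with h | rfl | h
    · exact hDlt _ _ h
    · have hij : i ≠ j := fun h => hne (by rw [h])
      exact ((hQd k hij).preimage Prod.fst).mono Set.inter_subset_right Set.inter_subset_right
    · exact (hDlt _ _ h).symm
  have hDc : ∀ᵐ p ∂halfSpaceMeasure n, f p ≠ 0 → ∃ i, p ∈ D i := by
    filter_upwards [hcover, ae_halfSpaceMeasure_pos] with p hp hpos hfp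
    obtain ⟨l, hl⟩ := hexit p hpos
    -- The piece containing `p` belongs to the last tent that contains `p`.
    obtain ⟨k, hk, hmax⟩ := Int.exists_greatest_of_bdd (P := fun k => p ∈ tent (E k))
      ⟨l, fun z hz => by
        by_contra! h
        exact hl (hEanti h.le hz)⟩ (hp hfp)
    obtain ⟨j, hj⟩ := Set.mem_iUnion.1 (hQc k (hk.2 (Metric.mem_ball_self hpos)))
    refine ⟨(k, j), ⟨hk, fun h => ?_⟩, hj⟩
    have := hmax _ h
    lia
  let e : ℕ ≃ ℤ × ℕ := (Denumerable.eqv (ℤ × ℕ)).symm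
  refine ⟨fun i => D (e i), fun i => c (e i).1 (e i).2, fun i => r (e i).1 (e i).2,
    fun i => N * 2 ^ ((e i).1 + 1), fun i => hDm _, fun i j hij => hDd _ _ (e.injective.ne hij),
    ?_, fun i p hp => hQt _ _ p hp.1.1 hp.2, fun i => ⟨?_, ?_⟩, fun i => ?_, ?_⟩
  · filter_upwards [hDc] with p hp hfp
    obtain ⟨i, hi⟩ := hp hfp
    exact Set.mem_iUnion.2 ⟨e.symm i, by simpa using hi⟩
  · exact mul_ne_zero (by simp; lia) (hpow0 _)
  · exact ENNReal.mul_ne_top (by simp) (hpowtop _)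
  · exact hbound _ _ (hDm _) (Set.disjoint_left.2 fun p hp => hp.1.2)
  · rw [e.tsum_eq fun i : ℤ × ℕ => (N : ℝ≥0∞) * 2 ^ (i.1 + 1)
      * volume (Metric.ball (c i.1 i.2) (r i.1 i.2)), ENNReal.tsum_prod (f := fun k j => (N : ℝ≥0∞) * 2 ^ (k + 1)
      * volume (Metric.ball (c k j) (r k j)))]
    simp only [ENNReal.tsum_mul_left]
    calc ∑' k : ℤ, (N : ℝ≥0∞) * 2 ^ (k + 1) * ∑' j, volume (Metric.ball (c k j) (r k j))
        ≤ ∑' k : ℤ, (N * (2 * 12 ^ n * 5 ^ n * 64 ^ n)) * (2 ^ k * volume (O k)) := by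
          refine ENNReal.tsum_le_tsum fun k => ?_
          calc (N : ℝ≥0∞) * 2 ^ (k + 1) * ∑' j, volume (Metric.ball (c k j) (r k j))
              ≤ N * 2 ^ (k + 1) * (12 ^ n * (5 ^ n * 64 ^ n * volume (O k))) := by
                gcongr
                exact (hQv k).trans (mul_le_mul_right (hEvol k) _)
            _ = _ := by
                rw [ENNReal.zpow_add (by norm_num) (by norm_num), zpow_one]
                ring
      _ = (N * (2 * 12 ^ n * 5 ^ n * 64 ^ n)) * ∑' k : ℤ, 2 ^ k * volume (O k) :=
          ENNReal.tsum_mul_left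
      _ ≤ (N * (2 * 12 ^ n * 5 ^ n * 64 ^ n)) * (2 * tentNorm W f) := by gcongr
      _ = _ := by ring

end Decomposition

/-! ### Atomic series -/

section AtomicSeries

open GaussianRandomMeasure

variable {n : ℕ} {Ω : Type*} [MeasurableSpace Ω] {P : Measure Ω}
  {W : GaussianRandomMeasure (halfSpaceMeasure n) P}
  {X : Type*} [NormedAddCommGroup X] [NormedSpace ℝ X]

theorem cone_indicator_indicator {Y : Type*} [Zero Y] (f : EuclideanSpace ℝ (Fin n) × ℝ → Y)
    (D : Set (EuclideanSpace ℝ (Fin n) × ℝ)) (x : EuclideanSpace ℝ (Fin n)) :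
    (cone x).indicator (D.indicator f) = D.indicator ((cone x).indicator f) := by
  rw [Set.indicator_indicator, Set.indicator_indicator, Set.inter_comm]

theorem isTentAtom_zero : IsTentAtom W (0 : TentFunction W X) := by
  have h0 : ∀ x : EuclideanSpace ℝ (Fin n),
      (cone x).indicator (0 : EuclideanSpace ℝ (Fin n) × ℝ → X) = 0 := fun x =>
    Set.indicator_zero' _
  change IsTentAtom W (0 : EuclideanSpace ℝ (Fin n) × ℝ → X)
  refine ⟨0, 1, one_pos, by simp, Filter.Eventually.of_forall fun x => ?_, ?_⟩
  · rw [h0]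
    exact memL2Tensor_zero
  · simp [h0, secondMoment_eq_gaussianNorm_sq, gaussianNorm_zero]

/-- The tails of a partition tend to zero in norm, by dominated convergence. -/
theorem tendsto_tentNorm_indicator_compl_biUnion [IsProbabilityMeasure P]
    {f : EuclideanSpace ℝ (Fin n) × ℝ → X}
    (hf : ∀ᵐ x : EuclideanSpace ℝ (Fin n),
      MemL2Tensor (halfSpaceMeasure n) ((cone x).indicator f)) (hf' : tentNorm W f ≠ ∞)
    {D : ℕ → Set (EuclideanSpace ℝ (Fin n) × ℝ)} (hD : ∀ i, MeasurableSet (D i))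
    (hfD : ∀ᵐ p ∂halfSpaceMeasure n, f p ≠ 0 → p ∈ ⋃ i, D i) :
    Filter.Tendsto (fun F : Finset ℕ => tentNorm W ((⋃ i ∈ F, D i)ᶜ.indicator f))
      Filter.atTop (nhds 0) := by
  have hV : ∀ F : Finset ℕ, MeasurableSet (⋃ i ∈ F, D i) := fun F =>
    F.measurableSet_biUnion fun i _ => hD i
  have hDU : MeasurableSet (⋃ i, D i) := MeasurableSet.iUnion hD
  have h2 : Filter.Tendsto (fun F : Finset ℕ => ∫⁻ x : EuclideanSpace ℝ (Fin n),
      W.gaussianNorm ((cone x).indicator ((⋃ i ∈ F, D i)ᶜ.indicator f))) Filter.atTop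
      (nhds (∫⁻ _ : EuclideanSpace ℝ (Fin n), 0)) := by
    refine tendsto_lintegral_filter_of_dominated_convergence'
      (fun x => W.gaussianNorm ((cone x).indicator f)) ?_ ?_ hf' ?_
    · refine Filter.Eventually.of_forall fun F => aemeasurable_gaussianNorm_cone ?_
      filter_upwards [hf] with x hx
      rw [cone_indicator_indicator]
      exact hx.indicator (hV F).compl
    · refine Filter.Eventually.of_forall fun F => ?_
      filter_upwards [hf] with x hx
      rw [cone_indicator_indicator]
      exact gaussianNorm_indicator_le hx (hV F).compl
    · filter_upwards [hf] with x hx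
      have h3 := tendsto_gaussianNorm_indicator (W := W) (l := Filter.atTop)
        (A := fun F : Finset ℕ => (⋃ i, D i) \ ⋃ i ∈ F, D i) (fun F => hDU.diff (hV F))
        (Filter.Eventually.of_forall fun p => ?_) hx
      · refine h3.congr fun F => ?_
        rw [cone_indicator_indicator]
        refine gaussianNorm_congr (hx.indicator (hDU.diff (hV F))) ?_
        filter_upwards [hfD] with p hp
        by_cases h0 : f p = 0
        · have h1 : (cone x).indicator f p = 0 := Set.indicator_apply_eq_zero.2 fun _ => h0
          rw [Set.indicator_apply_eq_zero.2 fun _ => h1, Set.indicator_apply_eq_zero.2 fun _ => h1]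
        · by_cases hpV : p ∈ ⋃ i ∈ F, D i
          · exact (Set.indicator_of_notMem (fun h => h.2 hpV) _).trans
              (Set.indicator_of_notMem (not_not.2 hpV) _).symm
          · exact (Set.indicator_of_mem
              (show p ∈ (⋃ i, D i) \ ⋃ i ∈ F, D i from ⟨hp h0, hpV⟩) _).trans
              (Set.indicator_of_mem (Set.mem_compl hpV) _).symm
      · by_cases hp : p ∈ ⋃ i, D i
        · obtain ⟨i, hi⟩ := Set.mem_iUnion.1 hp
          filter_upwards [Filter.eventually_ge_atTop {i}] with F hF
          exact fun h => h.2 (Set.mem_biUnion (hF (Finset.mem_singleton_self i)) hi)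
        · exact Filter.Eventually.of_forall fun F h => hp h.1
  rwa [lintegral_zero] at h2

namespace TentFunction

/-- The evaluation of `T¹(X)` functions, as an additive map. -/
def coeAddHom : TentFunction W X →+ (EuclideanSpace ℝ (Fin n) × ℝ → X) where
  toFun f := f
  map_zero' := rfl
  map_add' _ _ := rfl

theorem smul_apply (c : ℝ) (f : TentFunction W X) (p : EuclideanSpace ℝ (Fin n) × ℝ) :
    (c • f) p = c • f p := rfl

variable [IsProbabilityMeasure P]

/-- The restriction `1_D f` of a `T¹(X)` function to a measurable set. -/
noncomputable def restrict (f : TentFunction W X) {D : Set (EuclideanSpace ℝ (Fin n) × ℝ)}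
    (hD : MeasurableSet D) : TentFunction W X :=
  ⟨D.indicator f, by
    filter_upwards [f.2.1] with x hx
    rw [cone_indicator_indicator]
    exact hx.indicator hD, by
    refine lt_of_le_of_lt (lintegral_mono_ae ?_) f.2.2
    filter_upwards [f.2.1] with x hx
    rw [cone_indicator_indicator]
    exact gaussianNorm_indicator_le hx hD⟩

theorem restrict_apply (f : TentFunction W X) {D : Set (EuclideanSpace ℝ (Fin n) × ℝ)}
    (hD : MeasurableSet D) (p : EuclideanSpace ℝ (Fin n) × ℝ) :
    f.restrict hD p = D.indicator f p := rfl

/-- A partition into measurable sets decomposes a `T¹(X)` function unconditionally in norm. -/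
theorem hasSum_restrict (f : TentFunction W X) {D : ℕ → Set (EuclideanSpace ℝ (Fin n) × ℝ)}
    (hD : ∀ i, MeasurableSet (D i)) (hd : Pairwise fun i j => Disjoint (D i) (D j))
    (hf : ∀ᵐ p ∂halfSpaceMeasure n, f p ≠ 0 → p ∈ ⋃ i, D i) :
    HasSum (fun i => f.restrict (hD i)) f := by
  have hV : ∀ F : Finset ℕ, MeasurableSet (⋃ i ∈ F, D i) := fun F =>
    F.measurableSet_biUnion fun i _ => hD i
  have hsub : ∀ F : Finset ℕ, f - ∑ i ∈ F, f.restrict (hD i) = f.restrict (hV F).compl := by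
    intro F
    apply Subtype.ext
    change coeAddHom (f - ∑ i ∈ F, f.restrict (hD i)) = coeAddHom (f.restrict (hV F).compl)
    rw [map_sub, map_sum, sub_eq_iff_eq_add, add_comm]
    have h1 : ∑ i ∈ F, coeAddHom (f.restrict (hD i)) = (⋃ i ∈ F, D i).indicator f := by
      have := Finset.indicator_biUnion F D (fun i _ j _ hij => hd hij) (f := coeAddHom f)
      ext p
      rw [Finset.sum_apply]
      exact (congrFun this p).symm
    rw [h1]
    exact (Set.indicator_self_add_compl (⋃ i ∈ F, D i) (coeAddHom f)).symm
  have hlim := tendsto_tentNorm_indicator_compl_biUnion f.2.1 f.2.2.ne hD hf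
  rw [HasSum, SummationFilter.unconditional_filter, tendsto_iff_norm_sub_tendsto_zero]
  have h4 := (ENNReal.tendsto_toReal ENNReal.zero_ne_top).comp hlim
  rw [ENNReal.toReal_zero] at h4
  refine h4.congr fun F => ?_
  rw [norm_sub_rev, hsub]
  rfl

/-- The pieces `1_D f` of `exists_pieces`, normalized by `λ = M |B|`, are atoms: over every cone
they have norm at most `|B|⁻¹`. -/
theorem exists_atomic_decomposition (hn : 1 ≤ n) {N : ℕ} (hN : 1 ≤ N)
    (hcone : ∀ (O : Set (EuclideanSpace ℝ (Fin n))), IsOpen O → ∀ x : EuclideanSpace ℝ (Fin n),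
      ∃ s : Finset (EuclideanSpace ℝ (Fin n)), s.card ≤ N ∧ (∀ z ∈ s, z ∉ O) ∧
        cone x \ tent (densityHull O) ⊆ ⋃ z ∈ s, cone z) (f : TentFunction W X) :
    ∃ (c : ℕ → ℝ) (a : ℕ → TentFunction W X), (∀ k, IsTentAtom W (a k)) ∧ (∀ k, ‖a k‖ ≤ 1) ∧
      HasSum (fun k => c k • a k) f ∧
      (∀ᵐ p ∂halfSpaceMeasure n, HasSum (fun k => c k • a k p) (f p)) ∧
      Summable (fun k => |c k|) ∧
      ∑' k, |c k| ≤ (N * (4 * 12 ^ n * 5 ^ n * 64 ^ n) : ℝ) * ‖f‖ := by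
  obtain ⟨D, b, r, M, hDm, hDd, hDf, hDt, hM, hDM, hsum⟩ :=
    exists_pieces hn hN hcone f.2.1 f.2.2.ne
  have htop : ∑' i, M i * volume (Metric.ball (b i) (r i)) ≠ ∞ := by
    refine ne_top_of_le_ne_top (ENNReal.mul_ne_top ?_ f.2.2.ne) hsum
    exact_mod_cast ENNReal.natCast_ne_top (N * (4 * 12 ^ n * 5 ^ n * 64 ^ n))
  let lam : ℕ → ℝ := fun i => (M i * volume (Metric.ball (b i) (r i))).toReal
  have hlam0 : ∀ i, 0 ≤ lam i := fun i => ENNReal.toReal_nonneg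
  have hball : ∀ i, volume (Metric.ball (b i) (r i)) ≠ ∞ := fun i => measure_ball_lt_top.ne
  -- Unused indices have `r i ≤ 0`; their coefficient is `0` and their piece is empty.
  have hnonpos : ∀ i, r i ≤ 0 → f.restrict (hDm i) = 0 := by
    intro i hi
    have : D i = ∅ := by
      refine Set.eq_empty_of_forall_notMem fun p hp => ?_
      have := (hDt i hp).2 (Metric.mem_ball_self (hDt i hp).1)
      rw [Metric.ball_eq_empty.2 hi] at this
      exact this
    apply Subtype.ext
    change (D i).indicator f = 0
    rw [this, Set.indicator_empty']
  have hlam : ∀ i, lam i • (lam i)⁻¹ • f.restrict (hDm i) = f.restrict (hDm i) := by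
    intro i
    rcases le_or_gt (r i) 0 with hi | hi
    · rw [hnonpos i hi, smul_zero, smul_zero]
    · refine smul_inv_smul₀ ?_ _
      exact (ENNReal.toReal_pos (mul_ne_zero (hM i).1 (Metric.measure_ball_pos _ _ hi).ne')
        (ENNReal.mul_ne_top (hM i).2 (hball i))).ne'
  have hbound : ∀ i, 0 < r i → ∀ᵐ x, W.gaussianNorm
      ((cone x).indicator ((lam i)⁻¹ • f.restrict (hDm i) : TentFunction W X))
        ≤ (volume (Metric.ball (b i) (r i)))⁻¹ := by
    intro i hi
    have hV0 : volume (Metric.ball (b i) (r i)) ≠ 0 := (Metric.measure_ball_pos _ _ hi).ne'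
    filter_upwards [hDM i, (f.restrict (hDm i)).2.1] with x hx hx'
    have e : (cone x).indicator ((lam i)⁻¹ • f.restrict (hDm i) : TentFunction W X)
        = fun p => (lam i)⁻¹ • (cone x).indicator (f.restrict (hDm i)) p :=
      Set.indicator_const_smul (cone x) (lam i)⁻¹ ((D i).indicator f)
    rw [e, gaussianNorm_smul hx']
    have hx2 : W.gaussianNorm ((cone x).indicator (f.restrict (hDm i))) ≤ M i := by
      change W.gaussianNorm ((cone x).indicator ((D i).indicator f)) ≤ M i
      rwa [Set.indicator_indicator]
    have hlp : lam i ≠ 0 := (ENNReal.toReal_pos (mul_ne_zero (hM i).1 hV0)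
        (ENNReal.mul_ne_top (hM i).2 (hball i))).ne'
    have he : ‖(lam i)⁻¹‖ₑ = (M i)⁻¹ * (volume (Metric.ball (b i) (r i)))⁻¹ := by
      rw [enorm_inv hlp, Real.enorm_eq_ofReal (hlam0 i),
        ENNReal.ofReal_toReal (ENNReal.mul_ne_top (hM i).2 (hball i)),
        ENNReal.mul_inv (Or.inl (hM i).1) (Or.inl (hM i).2)]
    rw [he]
    calc _ ≤ (M i)⁻¹ * (volume (Metric.ball (b i) (r i)))⁻¹ * M i := by gcongr
      _ = (M i)⁻¹ * M i * (volume (Metric.ball (b i) (r i)))⁻¹ := by ring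
      _ = _ := by rw [ENNReal.inv_mul_cancel (hM i).1 (hM i).2, one_mul]
  have hsupp : ∀ i, Function.support ((lam i)⁻¹ • f.restrict (hDm i) : TentFunction W X)
      ⊆ tent (Metric.ball (b i) (r i)) := by
    intro i p hp
    refine hDt i ?_
    by_contra hpD
    refine hp ?_
    change (lam i)⁻¹ • (D i).indicator f p = 0
    rw [Set.indicator_of_notMem hpD, smul_zero]
  refine ⟨lam, fun i => (lam i)⁻¹ • f.restrict (hDm i), fun i => ?_, fun i => ?_, ?_, ?_, ?_, ?_⟩
  · rcases le_or_gt (r i) 0 with hi | hi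
    · change IsTentAtom W ((lam i)⁻¹ • f.restrict (hDm i) : TentFunction W X)
      have h0 : (lam i)⁻¹ • f.restrict (hDm i) = 0 := by rw [hnonpos i hi, smul_zero]
      exact h0 ▸ isTentAtom_zero
    have hV0 : volume (Metric.ball (b i) (r i)) ≠ 0 := (Metric.measure_ball_pos _ _ hi).ne'
    refine ⟨b i, r i, hi, hsupp i,
      ae_restrict_of_ae ((lam i)⁻¹ • f.restrict (hDm i) : TentFunction W X).2.1, ?_⟩
    calc ∫⁻ x in Metric.ball (b i) (r i), W.secondMoment
          ((cone x).indicator ((lam i)⁻¹ • f.restrict (hDm i) : TentFunction W X))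
        ≤ ∫⁻ _ in Metric.ball (b i) (r i), (volume (Metric.ball (b i) (r i)))⁻¹ ^ 2 := by
          refine lintegral_mono_ae (ae_restrict_of_ae ?_)
          filter_upwards [hbound i hi] with x hx
          rw [secondMoment_eq_gaussianNorm_sq]
          gcongr
      _ = (volume (Metric.ball (b i) (r i)))⁻¹ := by
          rw [setLIntegral_const, pow_two, mul_assoc, ENNReal.inv_mul_cancel hV0 (hball i),
            mul_one]
  · rcases le_or_gt (r i) 0 with hi | hi
    · have h0 : (lam i)⁻¹ • f.restrict (hDm i) = 0 := by rw [hnonpos i hi, smul_zero]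
      simp only [h0, norm_zero, zero_le_one]
    have hV0 : volume (Metric.ball (b i) (r i)) ≠ 0 := (Metric.measure_ball_pos _ _ hi).ne'
    refine ENNReal.toReal_le_of_le_ofReal zero_le_one ?_
    rw [ENNReal.ofReal_one]
    -- A cone with vertex `x` meets the tent over a ball only if `x` lies in the ball.
    calc tentNorm W ((lam i)⁻¹ • f.restrict (hDm i) : TentFunction W X)
        ≤ ∫⁻ x, (Metric.ball (b i) (r i)).indicator
            (fun _ => (volume (Metric.ball (b i) (r i)))⁻¹) x := by
          refine lintegral_mono_ae ?_
          filter_upwards [hbound i hi] with x hx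
          by_cases hxb : x ∈ Metric.ball (b i) (r i)
          · rwa [Set.indicator_of_mem hxb]
          · have h0 : (cone x).indicator
                ((lam i)⁻¹ • f.restrict (hDm i) : TentFunction W X) = 0 := by
              refine funext fun p => Set.indicator_apply_eq_zero.2 fun hp => ?_
              by_contra hne
              refine hxb ((hsupp i hne).2 ?_)
              rw [Metric.mem_ball, dist_eq_norm]
              exact hp
            rw [h0, gaussianNorm_zero]
            exact zero_le
      _ = 1 := by
          rw [lintegral_indicator_const measurableSet_ball,
            ENNReal.inv_mul_cancel hV0 (hball i)]
  · simp only [hlam]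
    exact f.hasSum_restrict hDm hDd hDf
  · filter_upwards [hDf] with p hp
    have h1 : ∀ i, lam i • ((lam i)⁻¹ • f.restrict (hDm i) : TentFunction W X) p
        = (D i).indicator f p := fun i => by
      rw [← smul_apply, hlam, restrict_apply]
    simp only [h1]
    by_cases h0 : f p = 0
    · rw [h0]
      exact hasSum_zero.congr_fun fun i => Set.indicator_apply_eq_zero.2 fun _ => h0
    · obtain ⟨i, hi⟩ := Set.mem_iUnion.1 (hp h0)
      rw [← Set.indicator_of_mem hi f]
      refine hasSum_single i fun j hj => Set.indicator_of_notMem ?_ _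
      exact (hDd hj.symm).notMem_of_mem_left hi
  · simp only [abs_of_nonneg (hlam0 _)]
    exact ENNReal.summable_toReal htop
  · simp only [abs_of_nonneg (hlam0 _), lam]
    rw [← ENNReal.tsum_toReal_eq fun i => ENNReal.mul_ne_top (hM i).2 (hball i), norm_def]
    refine (ENNReal.toReal_mono (ENNReal.mul_ne_top ?_ f.2.2.ne) hsum).trans_eq ?_
    · exact_mod_cast ENNReal.natCast_ne_top (N * (4 * 12 ^ n * 5 ^ n * 64 ^ n))
    · simp [ENNReal.toReal_mul, ENNReal.toReal_pow]

end TentFunction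

/-- Every element of a completion is the sum of a series of elements of the original space, at the
cost of a factor `2` in the norms. -/
theorem exists_hasSum_coe_completion {E : Type*} [SeminormedAddCommGroup E]
    {f : UniformSpace.Completion E} (hf : f ≠ 0) :
    ∃ g : ℕ → E, HasSum (fun k => (g k : UniformSpace.Completion E)) f ∧
      Summable (fun k => ‖g k‖) ∧ ∑' k, ‖g k‖ ≤ 2 * ‖f‖ := by
  have hpos : 0 < ‖f‖ := norm_pos_iff.2 hf
  let b : ℕ → ℝ := fun k => ‖f‖ / 2 / 2 ^ k
  have hb : HasSum b ‖f‖ := hasSum_geometric_two' ‖f‖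
  have hmem : f ∈ closure ((NormedAddCommGroup.toCompl (G := E)).toAddMonoidHom.range :
      Set (UniformSpace.Completion E)) := by
    rw [AddMonoidHom.coe_range]
    exact NormedAddCommGroup.denseRange_toCompl f
  obtain ⟨v, hv, hvs, hv0, hvb⟩ := controlled_sum_of_mem_closure hmem
    (b := b) fun k => by positivity
  choose g hg using hvs
  have hgv : ∀ k, (g k : UniformSpace.Completion E) = v k := hg
  have hnorm : ∀ k, ‖g k‖ ≤ b k + if k = 0 then ‖f‖ else 0 := by
    intro k
    rw [← UniformSpace.Completion.norm_coe, hgv]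
    rcases Nat.eq_zero_or_pos k with rfl | hk
    · have := norm_sub_le f (-v 0 + f)
      rw [show f - (-v 0 + f) = v 0 by abel] at this
      simp only [if_true]
      linarith
    · simpa [hk.ne'] using (hvb k hk).le
  have hbs : HasSum (fun k => b k + if k = 0 then ‖f‖ else 0) (‖f‖ + ‖f‖) :=
    hb.add (hasSum_ite_eq 0 ‖f‖)
  have hs : Summable fun k => ‖g k‖ :=
    Summable.of_nonneg_of_le (fun _ => norm_nonneg _) hnorm hbs.summable
  refine ⟨g, ?_, hs, ?_⟩
  · have hsv : Summable v := by
      refine Summable.of_norm ?_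
      simpa only [← hgv, UniformSpace.Completion.norm_coe] using hs
    have h1 := hsv.hasSum.tendsto_sum_nat.comp (Filter.tendsto_add_atTop_nat 1)
    simp only [hgv]
    rw [tendsto_nhds_unique hv h1]
    exact hsv.hasSum
  · refine (hs.tsum_le_tsum hnorm hbs.summable).trans_eq ?_
    rw [hbs.tsum_eq, two_mul]

theorem hasSum_smul_coe_completion {E : Type*} [SeminormedAddCommGroup E] [NormedSpace ℝ E]
    {c : ℕ → ℝ} {a : ℕ → E} {f : E} (h : HasSum (fun k => c k • a k) f) :
    HasSum (fun k => c k • (a k : UniformSpace.Completion E)) (f : UniformSpace.Completion E) := by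
  have := (UniformSpace.Completion.toComplL (𝕜 := ℝ) (E := E)).hasSum h
  refine this.congr_fun fun k => ?_
  exact (map_smul (UniformSpace.Completion.toComplL (𝕜 := ℝ) (E := E)) (c k) (a k)).symm

/-- Atomic decompositions extend from a space to its completion, the bound on the norms of the
atoms making the resulting double series absolutely convergent. -/
theorem exists_completion_decomposition {E : Type*} [SeminormedAddCommGroup E] [NormedSpace ℝ E]
    {p : E → Prop} {C : ℝ} (hC : 0 ≤ C)
    (hE : ∀ g : E, ∃ (c : ℕ → ℝ) (a : ℕ → E), (∀ k, p (a k)) ∧ (∀ k, ‖a k‖ ≤ 1) ∧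
      HasSum (fun k => c k • a k) g ∧ Summable (fun k => |c k|) ∧ ∑' k, |c k| ≤ C * ‖g‖)
    (f : UniformSpace.Completion E) :
    ∃ (c : ℕ → ℝ) (a : ℕ → E), (∀ k, p (a k)) ∧
      HasSum (fun k => c k • (a k : UniformSpace.Completion E)) f ∧
      Summable (fun k => |c k|) ∧ ∑' k, |c k| ≤ C * 2 * ‖f‖ := by
  rcases eq_or_ne f 0 with rfl | hf
  · obtain ⟨c, a, ha, _, hca, hc, hcn⟩ := hE 0
    refine ⟨c, a, ha, ?_, hc, by simpa using hcn⟩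
    simpa only [UniformSpace.Completion.coe_zero] using hasSum_smul_coe_completion hca
  obtain ⟨g, hgf, hgs, hgn⟩ := exists_hasSum_coe_completion hf
  choose c a ha ha1 hca hcs hcn using fun k => hE (g k)
  have hsum : Summable fun q : ℕ × ℕ => |c q.1 q.2| := by
    rw [summable_prod_of_nonneg fun q => abs_nonneg _]
    exact ⟨hcs, Summable.of_nonneg_of_le (fun k => tsum_nonneg fun _ => abs_nonneg _) hcn
      (hgs.mul_left C)⟩
  have hsumm : Summable fun q : ℕ × ℕ =>
      c q.1 q.2 • (a q.1 q.2 : UniformSpace.Completion E) := by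
    refine Summable.of_norm_bounded hsum fun q => ?_
    rw [norm_smul, UniformSpace.Completion.norm_coe, Real.norm_eq_abs]
    exact mul_le_of_le_one_right (abs_nonneg _) (ha1 _ _)
  have htot : HasSum (fun q : ℕ × ℕ => c q.1 q.2 • (a q.1 q.2 : UniformSpace.Completion E)) f := by
    have h1 := hsumm.hasSum.prod_fiberwise fun k => hasSum_smul_coe_completion (hca k)
    rw [hgf.unique h1]
    exact hsumm.hasSum
  obtain ⟨e⟩ : Nonempty (ℕ ≃ ℕ × ℕ) := ⟨Nat.pairEquiv.symm⟩
  refine ⟨fun i => c (e i).1 (e i).2, fun i => a (e i).1 (e i).2, fun i => ha _ _, ?_, ?_, ?_⟩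
  · exact e.hasSum_iff.2 htot
  · exact e.summable_iff.2 hsum
  · rw [e.tsum_eq fun q : ℕ × ℕ => |c q.1 q.2|, hsum.tsum_prod]
    calc ∑' k, ∑' j, |c k j| ≤ ∑' k, C * ‖g k‖ :=
          hsum.prod.tsum_le_tsum hcn (hgs.mul_left C)
      _ = C * ∑' k, ‖g k‖ := tsum_mul_left
      _ ≤ C * (2 * ‖f‖) := by gcongr
      _ = C * 2 * ‖f‖ := by ring

end AtomicSeries

theorem mainTheorem1 (n : ℕ) (hn : 1 ≤ n) :
    ∃ C : ℝ, 0 < C ∧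
      ∀ (X : Type u) [NormedAddCommGroup X] [NormedSpace ℝ X] [CompleteSpace X]
        (Ω : Type v) [MeasurableSpace Ω] (P : Measure Ω) [IsProbabilityMeasure P]
        (W : GaussianRandomMeasure (halfSpaceMeasure n) P),
        -- elements of the completed space
        (∀ f : TentSpace W X, ∃ (c : ℕ → ℝ) (a : ℕ → TentFunction W X),
          (∀ k, IsTentAtom W (a k)) ∧
          HasSum (fun k => c k • (a k : TentSpace W X)) f ∧
          Summable (fun k => |c k|) ∧ ∑' k, |c k| ≤ C * ‖f‖) ∧
        -- genuine functions, for which the series also converges almost everywhere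
        (∀ f : TentFunction W X, ∃ (c : ℕ → ℝ) (a : ℕ → TentFunction W X),
          (∀ k, IsTentAtom W (a k)) ∧
          HasSum (fun k => c k • (a k : TentSpace W X)) (f : TentSpace W X) ∧
          (∀ᵐ p ∂halfSpaceMeasure n, HasSum (fun k => c k • a k p) (f p)) ∧
          Summable (fun k => |c k|) ∧ ∑' k, |c k| ≤ C * ‖f‖) := by
  obtain ⟨N, hN, hcone⟩ := exists_cone_cover hn
  set C₀ : ℝ := N * (4 * 12 ^ n * 5 ^ n * 64 ^ n) with hC₀
  have hC₀pos : 0 < C₀ := by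
    have : (0 : ℝ) < N := by exact_mod_cast hN
    positivity
  refine ⟨C₀ * 2, by positivity, fun X _ _ _ Ω _ P _ W => ⟨fun f => ?_, fun f => ?_⟩⟩
  · refine exists_completion_decomposition
      (p := fun g : TentFunction W X => IsTentAtom W g) hC₀pos.le (fun g => ?_) f
    obtain ⟨c, a, ha, ha1, hsum, _, hcs, hcn⟩ := g.exists_atomic_decomposition hn hN hcone
    exact ⟨c, a, ha, ha1, hsum, hcs, hcn⟩
  · obtain ⟨c, a, ha, _, hsum, hae, hcs, hcn⟩ := f.exists_atomic_decomposition hn hN hcone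
    refine ⟨c, a, ha, hasSum_smul_coe_completion hsum, hae, hcs, hcn.trans ?_⟩
    exact mul_le_mul_of_nonneg_right (by linarith) (norm_nonneg f)
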